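/- Let $S\subset\mathbb{R}^2$ be a finite non-empty set of points in general position, meaning that no four points of $S$ lie on a common circle. For $p\in S$ let $\mathrm{cell}(p)$ be the set of points $q$ of the plane such that $d(q,p)=\max_{p'\in S}d(q,p')$. A vertex of the farthest-point Voronoi diagram of $S$ is a point $v$ for which there are three distinct points $p_1,p_2,p_3\in S$ (its defining points) with $\mathrm{cell}(p_1)\cap\mathrm{cell}(p_2)\cap\mathrm{cell}(p_3)=\{v\}$; an edge is a set $\mathrm{cell}(p_1)\cap\mathrm{cell}(p_2)$ with more than one point, where $p_1\ne p_2$ are points of $S$ (its defining points). The vertices and the bounded edges form a tree $T$ (which is empty if the diagram has no vertices). A centroid of a tree with $k$ vertices is a vertex whose removal leaves subtrees with at most $k/2$ vertices each. A centroid decomposition of a non-empty tree is the rooted tree obtained by choosing a centroid as the root and making the roots of centroid decompositions, formed recursively, of the remaining subtrees its children; that of the empty tree is empty. There are a fixed program for the real RAM (unit cost; operations $+,-,\times,/$ and comparisons on real registers; addition, subtraction and comparisons on index registers; random access to arrays; no square roots and no rounding) and a constant $K$ such that the following holds for every such $S$. Suppose that the memory contains the coordinates of the points of $S$; the farthest-point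 Voronoi diagram of $S$, that is, its vertices with their coordinates, three defining points and three incident edges each, and its edges with their defining points and their end vertices; and a centroid decomposition of $T$, that is, its root and, for each vertex, pointers to its at most three children; all listed in arbitrary order. Then the program halts after at most $K(1+\log|S|)$ steps and returns the coordinates of the centre and the square of the radius of the smallest enclosing disk of $S$. In particular, given $S$, its farthest-point Voronoi diagram and a centroid decomposition of the diagram, the smallest enclosing disk of $S$ can be found in time $O(\log|S|)$. -/

import Mathlib

noncomputable section

/-- The Euclidean plane. -/
abbrev Plane : Type := EuclideanSpace ℝ (Fin 2)

/-! ### Smallest enclosing disks and farthest-point Voronoi diagrams -/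

/-- The closed disk with centre `c` and radius `r` encloses `S` and no disk enclosing `S`
has a smaller radius. -/
def IsSmallestEnclosingDisk (S : Finset Plane) (c : Plane) (r : ℝ) : Prop :=
  0 ≤ r ∧ (S : Set Plane) ⊆ Metric.closedBall c r ∧
    ∀ (c' : Plane) (r' : ℝ), (S : Set Plane) ⊆ Metric.closedBall c' r' → r ≤ r'

/-- General position: no four points of `S` lie on a common circle. -/
def InGeneralPosition (S : Finset Plane) : Prop :=
  ∀ T : Finset Plane, T ⊆ S → T.card = 4 → ¬ EuclideanGeometry.Cospherical (T : Set Plane)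

/-- The cell of `p`: the points of the plane from which `p` is a farthest point of `S`. -/
def fpvdCell (S : Finset Plane) (p : Plane) : Set Plane :=
  {q | ∀ p' ∈ S, dist q p' ≤ dist q p}

/-- `p₁, p₂, p₃` are three defining points of the vertex `v`. -/
def DefinesVertex (S : Finset Plane) (p₁ p₂ p₃ v : Plane) : Prop :=
  p₁ ∈ S ∧ p₂ ∈ S ∧ p₃ ∈ S ∧ p₁ ≠ p₂ ∧ p₁ ≠ p₃ ∧ p₂ ≠ p₃ ∧
    fpvdCell S p₁ ∩ fpvdCell S p₂ ∩ fpvdCell S p₃ = {v}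

/-- `p₁, p₂` are the defining points of an edge, which is then the set
`fpvdCell S p₁ ∩ fpvdCell S p₂` (a segment, a half-line or a line). -/
def DefinesEdge (S : Finset Plane) (p₁ p₂ : Plane) : Prop :=
  p₁ ∈ S ∧ p₂ ∈ S ∧ p₁ ≠ p₂ ∧ (fpvdCell S p₁ ∩ fpvdCell S p₂).Nontrivial

/-- Tables describing a subdivision of the plane: sites, vertices with three defining sites and
three incident edges each, and edges with two defining sites and at most two end vertices each
(a missing end vertex means that the edge is unbounded on that side). -/
structure DiagramTables where
  numSites : ℕ
  numVertices : ℕ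
  numEdges : ℕ
  site : Fin numSites → Plane
  vertex : Fin numVertices → Plane
  vertexSite : Fin numVertices → Fin 3 → Fin numSites
  vertexEdge : Fin numVertices → Fin 3 → Fin numEdges
  edgeSite : Fin numEdges → Fin 2 → Fin numSites
  edgeEnd : Fin numEdges → Fin 2 → Option (Fin numVertices)

namespace DiagramTables

/-- The set of points on edge number `e`. -/
def edgeSet (D : DiagramTables) (S : Finset Plane) (e : Fin D.numEdges) : Set Plane :=
  fpvdCell S (D.site (D.edgeSite e 0)) ∩ fpvdCell S (D.site (D.edgeSite e 1))

/-- The tables `D` list the points of `S` and describe the farthest-point Voronoi diagram of `S`.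
The numbering of sites, vertices and edges, and the order in which the defining sites, incident
edges and end vertices are listed, are arbitrary. -/
structure IsFPVD (D : DiagramTables) (S : Finset Plane) : Prop where
  site_injective : Function.Injective D.site
  site_range : Set.range D.site = (S : Set Plane)
  vertex_injective : Function.Injective D.vertex
  vertex_range : Set.range D.vertex = {v | ∃ p₁ p₂ p₃, DefinesVertex S p₁ p₂ p₃ v}
  vertexSite_spec : ∀ j, DefinesVertex S (D.site (D.vertexSite j 0)) (D.site (D.vertexSite j 1))
    (D.site (D.vertexSite j 2)) (D.vertex j)
  edgeSite_spec : ∀ e, DefinesEdge S (D.site (D.edgeSite e 0)) (D.site (D.edgeSite e 1))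
  edge_complete : ∀ p q, DefinesEdge S p q →
    ∃! e, s(D.site (D.edgeSite e 0), D.site (D.edgeSite e 1)) = s(p, q)
  vertexEdge_spec : ∀ j e, (∃ k, D.vertexEdge j k = e) ↔ D.vertex j ∈ D.edgeSet S e
  edgeEnd_spec : ∀ e j, (∃ k, D.edgeEnd e k = some j) ↔ D.vertex j ∈ D.edgeSet S e
  edgeEnd_ne : ∀ e j, D.edgeEnd e 0 = some j → D.edgeEnd e 1 ≠ some j

/-- The tree formed by the vertices and the bounded edges of the diagram. -/
def graph (D : DiagramTables) : SimpleGraph (Fin D.numVertices) where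
  Adj i j := i ≠ j ∧ ∃ e, (∃ k, D.edgeEnd e k = some i) ∧ (∃ k, D.edgeEnd e k = some j)
  symm := ⟨fun _ _ h => ⟨h.1.symm, h.2.imp fun _ he => he.symm⟩⟩
  loopless := ⟨fun _ h => h.1 rfl⟩

end DiagramTables

/-! ### Centroid decompositions -/

/-- The vertex sets of the connected components that remain when `v` is removed from the subgraph
of `G` induced by `A`. -/
def piecesAfterRemoval {V : Type*} (G : SimpleGraph V) (A : Set V) (v : V) : Set (Set V) :=
  Set.range fun c : (G.induce (A \ {v})).ConnectedComponent => Subtype.val '' c.supp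

/-- `IsCentroidTree G child A v`: the rooted tree with root `v` described by the child pointers
`child` is a centroid decomposition of the subgraph of `G` induced by `A`. That is, `v` is a
centroid of it, and the children of `v` are the roots of centroid decompositions of the pieces
that remain when `v` is removed, one child for each piece. -/
inductive IsCentroidTree {V : Type*} (G : SimpleGraph V) (child : V → Fin 3 → Option V) :
    Set V → V → Prop
  | node (A : Set V) (v : V) (mem : v ∈ A)
      (half : ∀ C ∈ piecesAfterRemoval G A v, 2 * C.ncard ≤ A.ncard)
      (child_mem : ∀ i w, child v i = some w → w ∈ A \ {v})
      (one_child : ∀ C ∈ piecesAfterRemoval G A v, ∃! i, ∃ w ∈ C, child v i = some w)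
      (sub : ∀ C ∈ piecesAfterRemoval G A v, ∀ i, ∀ w ∈ C, child v i = some w →
        IsCentroidTree G child C w) :
      IsCentroidTree G child A v

/-- Centroid decomposition of `G`, given by its root and the child pointers; there is no root if
`G` has no vertices. -/
def IsCentroidDecomposition {V : Type*} (G : SimpleGraph V) (root : Option V)
    (child : V → Fin 3 → Option V) : Prop :=
  (root = none → IsEmpty V) ∧ ∀ r, root = some r → IsCentroidTree G child Set.univ r

/-! ### Real RAM programs with unit cost -/

namespace RealRAM

/-- A state: registers and random access arrays for natural numbers (indices, pointers) and for
real numbers. -/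
structure State where
  nat : ℕ → ℕ
  real : ℕ → ℝ
  natArr : ℕ → ℕ → ℕ
  realArr : ℕ → ℕ → ℝ

/-- Elementary operations. The first argument of all but the two store operations is the target
register; array names are fixed in the program, indices are read from a register. -/
inductive Op
  | nconst (r c : ℕ)
  | ncopy (r s : ℕ)
  | nadd (r s t : ℕ)
  | nsub (r s t : ℕ)
  | nload (r arr i : ℕ)
  | nstore (arr i s : ℕ)
  | rconst (r : ℕ) (c : ℤ)
  | rcopy (r s : ℕ)
  | radd (r s t : ℕ)
  | rsub (r s t : ℕ)
  | rmul (r s t : ℕ)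
  | rdiv (r s t : ℕ)
  | rload (r arr i : ℕ)
  | rstore (arr i s : ℕ)

open Function in
/-- The effect of an elementary operation. -/
def Op.apply : Op → State → State
  | nconst r c, σ => { σ with nat := update σ.nat r c }
  | ncopy r s, σ => { σ with nat := update σ.nat r (σ.nat s) }
  | nadd r s t, σ => { σ with nat := update σ.nat r (σ.nat s + σ.nat t) }
  | nsub r s t, σ => { σ with nat := update σ.nat r (σ.nat s - σ.nat t) }
  | nload r a i, σ => { σ with nat := update σ.nat r (σ.natArr a (σ.nat i)) }
  | nstore a i s, σ =>
    { σ with natArr := update σ.natArr a (update (σ.natArr a) (σ.nat i) (σ.nat s)) }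
  | rconst r c, σ => { σ with real := update σ.real r (c : ℝ) }
  | rcopy r s, σ => { σ with real := update σ.real r (σ.real s) }
  | radd r s t, σ => { σ with real := update σ.real r (σ.real s + σ.real t) }
  | rsub r s t, σ => { σ with real := update σ.real r (σ.real s - σ.real t) }
  | rmul r s t, σ => { σ with real := update σ.real r (σ.real s * σ.real t) }
  | rdiv r s t, σ => { σ with real := update σ.real r (σ.real s / σ.real t) }
  | rload r a i, σ => { σ with real := update σ.real r (σ.realArr a (σ.nat i)) }
  | rstore a i s, σ =>
    { σ with realArr := update σ.realArr a (update (σ.realArr a) (σ.nat i) (σ.real s)) }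

/-- Elementary tests: comparisons of two registers. -/
inductive Test
  | natEq (r s : ℕ)
  | natLt (r s : ℕ)
  | realEq (r s : ℕ)
  | realLt (r s : ℕ)

/-- The meaning of the tests. -/
def Test.Holds : Test → State → Prop
  | natEq r s, σ => σ.nat r = σ.nat s
  | natLt r s, σ => σ.nat r < σ.nat s
  | realEq r s, σ => σ.real r = σ.real s
  | realLt r s, σ => σ.real r < σ.real s

/-- Structured programs. -/
inductive Program
  | skip
  | op (o : Op)
  | seq (P Q : Program)
  | ite (b : Test) (P Q : Program)
  | loop (b : Test) (P : Program)

/-- `Exec P σ τ t`: started in state `σ`, the program `P` halts in state `τ` after `t` steps,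
where every elementary operation and every elementary test counts as one step. The program
`loop b P` repeats `P` as long as `b` holds. -/
inductive Exec : Program → State → State → ℕ → Prop
  | skip (σ : State) : Exec .skip σ σ 0
  | op (o : Op) (σ : State) : Exec (.op o) σ (o.apply σ) 1
  | seq {P Q : Program} {σ τ ρ : State} {s t : ℕ} :
      Exec P σ τ s → Exec Q τ ρ t → Exec (.seq P Q) σ ρ (s + t)
  | ite_true {b : Test} {P Q : Program} {σ τ : State} {t : ℕ} :
      b.Holds σ → Exec P σ τ t → Exec (.ite b P Q) σ τ (t + 1)
  | ite_false {b : Test} {P Q : Program} {σ τ : State} {t : ℕ} :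
      ¬ b.Holds σ → Exec Q σ τ t → Exec (.ite b P Q) σ τ (t + 1)
  | loop_true {b : Test} {P : Program} {σ τ ρ : State} {s t : ℕ} :
      b.Holds σ → Exec P σ τ s → Exec (.loop b P) τ ρ t → Exec (.loop b P) σ ρ (s + t + 1)
  | loop_false {b : Test} {P : Program} {σ : State} :
      ¬ b.Holds σ → Exec (.loop b P) σ σ 1

/-- Optional pointers in memory: `0` is the null pointer, `j + 1` points to record `j`. -/
def encodePointer {m : ℕ} : Option (Fin m) → ℕ
  | none => 0
  | some j => j + 1

/-- The memory contains the tables `D`, the root pointer and the child pointers. All registers and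
array entries that are not mentioned have arbitrary contents. -/
structure HoldsInput (σ : State) (D : DiagramTables) (root : Option (Fin D.numVertices))
    (child : Fin D.numVertices → Fin 3 → Option (Fin D.numVertices)) : Prop where
  numSites : σ.nat 0 = D.numSites
  numVertices : σ.nat 1 = D.numVertices
  numEdges : σ.nat 2 = D.numEdges
  root : σ.nat 3 = encodePointer root
  site : ∀ (i : Fin D.numSites) (k : Fin 2), σ.realArr k i = D.site i k
  vertex : ∀ (j : Fin D.numVertices) (k : Fin 2), σ.realArr (2 + k) j = D.vertex j k
  vertexSite : ∀ (j : Fin D.numVertices) (k : Fin 3), σ.natArr k j = D.vertexSite j k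
  child : ∀ (j : Fin D.numVertices) (k : Fin 3), σ.natArr (3 + k) j = encodePointer (child j k)
  vertexEdge : ∀ (j : Fin D.numVertices) (k : Fin 3), σ.natArr (6 + k) j = D.vertexEdge j k
  edgeSite : ∀ (e : Fin D.numEdges) (k : Fin 2), σ.natArr (9 + k) e = D.edgeSite e k
  edgeEnd : ∀ (e : Fin D.numEdges) (k : Fin 2),
    σ.natArr (11 + k) e = encodePointer (D.edgeEnd e k)

/-- The real registers `0, 1` contain the coordinates of the centre and the real register `2`
contains the square of the radius of the smallest enclosing disk of `S`. -/
def HoldsSmallestEnclosingDisk (σ : State) (S : Finset Plane) : Prop :=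
  ∃ (c : Plane) (r : ℝ), IsSmallestEnclosingDisk S c r ∧
    σ.real 0 = c 0 ∧ σ.real 1 = c 1 ∧ σ.real 2 = r ^ 2

end RealRAM

end

/-! A diagram vertex `v` is the circumcentre of its defining triangle `p q r`, and the disk around it
encloses `S`. If no angle is obtuse, this disk is optimal. If the angle at `r` is obtuse, the disk
with diameter `p q` bounds the answer from below. Unless that disk is already optimal, the descent
to the smallest enclosing disk ends at a *terminal* vertex, which lies outside of the cone with apex
`v` opposite to the angle `p v q`. An edge that avoids `v` does not cross the boundary of this cone,
and the only edge at `v` that leaves it is that of `p` and `q`. Hence all terminal vertices lie in a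
single piece of the tree without `v`, and testing the three children of `v` against the cone finds
it. The visited vertices are the centroids of pieces whose sizes halve, so `O(log |S|)` visits
suffice, and the largest of the disks found on the way, all of which are lower bounds, is optimal.
-/

open scoped RealInnerProductSpace

/-! ### Lower bounds for enclosing disks -/

/-- A disk, given by its centre and the square of its radius; the real RAM has no square roots. -/
@[ext]
structure Disk (X : Type*) where
  center : X
  sqRadius : ℝ

namespace Disk

/-- The one of two lower bounds that has the larger radius. -/
noncomputable def larger {X : Type*} (d d' : Disk X) : Disk X :=
  if d.sqRadius < d'.sqRadius then d' else d

theorem sqRadius_le_larger_left {X : Type*} (d d' : Disk X) :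
    d.sqRadius ≤ (d.larger d').sqRadius := by
  unfold Disk.larger
  split_ifs with h
  exacts [h.le, le_rfl]

theorem sqRadius_le_larger_right {X : Type*} (d d' : Disk X) :
    d'.sqRadius ≤ (d.larger d').sqRadius := by
  unfold Disk.larger
  split_ifs with h
  exacts [le_rfl, not_lt.1 h]

section PseudoMetricSpace

variable {X : Type*} [PseudoMetricSpace X] {d d' : Disk X} {S : Set X}

/-- All points of `S` lie in the disk `d`. -/
def Encloses (d : Disk X) (S : Set X) : Prop :=
  ∀ p ∈ S, dist d.center p ^ 2 ≤ d.sqRadius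

/-- The disk `d` bounds the disks that enclose `S` from below: such a disk with centre `x` has a
squared radius of at least `d.sqRadius + dist x d.center ^ 2`. -/
def IsLowerBound (d : Disk X) (S : Set X) : Prop :=
  ∀ x, ∃ p ∈ S, d.sqRadius + dist x d.center ^ 2 ≤ dist x p ^ 2

/-- The disk `d` certifies itself as the smallest enclosing disk of `S`. -/
structure IsOptimal (d : Disk X) (S : Set X) : Prop where
  encloses : d.Encloses S
  isLowerBound : d.IsLowerBound S

/-- The disk with centre `v` whose boundary contains `p`. -/
noncomputable def through (v p : X) : Disk X :=
  ⟨v, dist v p ^ 2⟩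

theorem IsLowerBound.sqRadius_add_le (hd : d.IsLowerBound S) (hd' : d'.Encloses S) :
    d.sqRadius + dist d'.center d.center ^ 2 ≤ d'.sqRadius := by
  obtain ⟨p, hp, h⟩ := hd d'.center
  exact h.trans (hd' p hp)

theorem IsLowerBound.sqRadius_le (hd : d.IsLowerBound S) (hd' : d'.Encloses S) :
    d.sqRadius ≤ d'.sqRadius :=
  (le_add_of_nonneg_right (sq_nonneg _)).trans (hd.sqRadius_add_le hd')

theorem IsLowerBound.larger (hd : d.IsLowerBound S) (hd' : d'.IsLowerBound S) :
    (d.larger d').IsLowerBound S := by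
  unfold Disk.larger
  split_ifs <;> assumption

theorem IsOptimal.sqRadius_nonneg (hd : d.IsOptimal S) : 0 ≤ d.sqRadius := by
  obtain ⟨p, hp, -⟩ := hd.isLowerBound d.center
  exact (sq_nonneg _).trans (hd.encloses p hp)

end PseudoMetricSpace

section MetricSpace

variable {X : Type*} [MetricSpace X] {d d' : Disk X} {S : Set X}

theorem IsLowerBound.eq_of_isOptimal (hd : d.IsLowerBound S) (hd' : d'.IsOptimal S)
    (h : d'.sqRadius ≤ d.sqRadius) : d = d' := by
  have hle := hd.sqRadius_add_le hd'.encloses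
  have hdist : dist d'.center d.center ^ 2 ≤ 0 := by linarith
  have hcenter : d'.center = d.center :=
    dist_eq_zero.1 (pow_eq_zero_iff two_ne_zero |>.1 (hdist.antisymm (sq_nonneg _)))
  exact Disk.ext hcenter.symm (by nlinarith [sq_nonneg (dist d'.center d.center)])

theorem IsOptimal.eq (hd : d.IsOptimal S) (hd' : d'.IsOptimal S) : d = d' :=
  hd.isLowerBound.eq_of_isOptimal hd' (hd'.isLowerBound.sqRadius_le hd.encloses)

theorem IsLowerBound.isOptimal_larger (hd : d.IsLowerBound S) (hd' : d'.IsLowerBound S)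
    (h : d.IsOptimal S ∨ d'.IsOptimal S) : (d.larger d').IsOptimal S := by
  rcases h with h | h
  · rwa [(hd.larger hd').eq_of_isOptimal h (sqRadius_le_larger_left d d')]
  · rwa [(hd.larger hd').eq_of_isOptimal h (sqRadius_le_larger_right d d')]

end MetricSpace

section InnerProductSpace

variable {E : Type*} [NormedAddCommGroup E] [InnerProductSpace ℝ E] {S : Set E} {p q : E}

/-- The disk with diameter `p q`. -/
noncomputable def diametral (p q : E) : Disk E :=
  through (midpoint ℝ p q) p

theorem diametral_comm (p q : E) : diametral p q = diametral q p := by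
  rw [diametral, diametral, midpoint_comm q p, through, through, dist_midpoint_left,
    dist_midpoint_right]

theorem isLowerBound_diametral (hp : p ∈ S) (hq : q ∈ S) : (diametral p q).IsLowerBound S := by
  intro x
  have hmedian :=
    EuclideanGeometry.dist_sq_add_dist_sq_eq_two_mul_dist_midpoint_sq_add_half_dist_sq x p q
  have hradius : dist (midpoint ℝ p q) p = dist p q / 2 := by
    rw [dist_midpoint_left, Real.norm_ofNat, inv_mul_eq_div]
  simp only [diametral, through, hradius]
  rcases le_total (dist x p ^ 2) (dist x q ^ 2) with h | h
  · exact ⟨q, hq, by linarith⟩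
  · exact ⟨p, hp, by linarith⟩

end InnerProductSpace

end Disk

theorem Disk.IsOptimal.isSmallestEnclosingDisk {S : Finset Plane} {d : Disk Plane}
    (hd : d.IsOptimal S) : IsSmallestEnclosingDisk S d.center √d.sqRadius := by
  refine ⟨Real.sqrt_nonneg _, fun p hp => ?_, fun c r hr => ?_⟩
  · rw [Metric.mem_closedBall, dist_comm]
    exact Real.le_sqrt_of_sq_le (hd.encloses p hp)
  · obtain ⟨p, hp, -⟩ := hd.isLowerBound c
    have hr₀ : 0 ≤ r := dist_nonneg.trans (hr hp)
    refine Real.sqrt_le_iff.2 ⟨hr₀, hd.isLowerBound.sqRadius_le (d' := ⟨c, r ^ 2⟩) fun q hq => ?_⟩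
    rw [dist_comm]
    exact pow_le_pow_left₀ dist_nonneg (hr hq) 2

/-! ### Cells and edges -/

section InnerProductSpace

variable {E : Type*} [NormedAddCommGroup E] [InnerProductSpace ℝ E]

theorem dist_sq_sub_dist_sq (x p q : E) :
    dist x p ^ 2 - dist x q ^ 2 = 2 * ⟪q - p, x⟫ + (‖p‖ ^ 2 - ‖q‖ ^ 2) := by
  rw [dist_eq_norm, dist_eq_norm, norm_sub_sq_real, norm_sub_sq_real, inner_sub_left,
    real_inner_comm p, real_inner_comm q]
  ring

theorem dist_le_dist_iff_inner_le {x p q : E} :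
    dist x p ≤ dist x q ↔ ⟪q - p, x⟫ ≤ (‖q‖ ^ 2 - ‖p‖ ^ 2) / 2 := by
  rw [← sq_le_sq₀ dist_nonneg dist_nonneg, ← sub_nonpos, dist_sq_sub_dist_sq]
  constructor <;> intro h <;> linarith

theorem convex_setOf_dist_le_dist (p q : E) : Convex ℝ {x | dist x p ≤ dist x q} := by
  simp only [dist_le_dist_iff_inner_le]
  exact convex_halfSpace_le (innerₛₗ ℝ (q - p)).isLinear _

theorem dist_sq_eq_dist_midpoint_sq_add {z p q : E} (h : dist z p = dist z q) :
    dist z p ^ 2 = dist z (midpoint ℝ p q) ^ 2 + dist p q ^ 2 / 4 := by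
  have := EuclideanGeometry.dist_sq_add_dist_sq_eq_two_mul_dist_midpoint_sq_add_half_dist_sq z p q
  rw [← h] at this
  linarith

theorem eq_of_equidistant_of_finrank_eq_two [FiniteDimensional ℝ E]
    (hE : Module.finrank ℝ E = 2) {v w p q r : E} (hpq : p ≠ q) (hpr : p ≠ r) (hqr : q ≠ r)
    (hv : dist v p = dist v q ∧ dist v p = dist v r)
    (hw : dist w p = dist w q ∧ dist w p = dist w r) : v = w := by
  by_contra hne
  rcases EuclideanGeometry.eq_of_dist_eq_of_dist_eq_of_finrank_eq_two hE hne hpq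
    (dist_comm p v) (by rw [hv.1, dist_comm]) (by rw [hv.2, dist_comm])
    (dist_comm p w) (by rw [hw.1, dist_comm]) (by rw [hw.2, dist_comm]) with h | h
  exacts [hpr h.symm, hqr h.symm]

end InnerProductSpace

section Cells

variable {S : Finset Plane} {p q r v x y z : Plane}

/-- The common boundary of two cells of the farthest-point Voronoi diagram. -/
def fpvdEdge (S : Finset Plane) (p q : Plane) : Set Plane :=
  fpvdCell S p ∩ fpvdCell S q

theorem fpvdEdge_comm (S : Finset Plane) (p q : Plane) : fpvdEdge S p q = fpvdEdge S q p :=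
  Set.inter_comm _ _

theorem fpvdCell_eq_iInter (S : Finset Plane) (p : Plane) :
    fpvdCell S p = ⋂ q ∈ S, {x | dist x q ≤ dist x p} := by
  ext
  simp only [fpvdCell, Set.mem_iInter, Set.mem_ofPred_eq]

theorem convex_fpvdCell (S : Finset Plane) (p : Plane) : Convex ℝ (fpvdCell S p) := by
  rw [fpvdCell_eq_iInter]
  exact convex_iInter₂ fun q _ => convex_setOf_dist_le_dist q p

theorem isClosed_fpvdCell (S : Finset Plane) (p : Plane) : IsClosed (fpvdCell S p) := by
  rw [fpvdCell_eq_iInter]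
  exact isClosed_biInter fun q _ => isClosed_le (by fun_prop) (by fun_prop)

theorem convex_fpvdEdge (S : Finset Plane) (p q : Plane) : Convex ℝ (fpvdEdge S p q) :=
  (convex_fpvdCell S p).inter (convex_fpvdCell S q)

theorem dist_eq_of_mem_fpvdEdge (hp : p ∈ S) (hq : q ∈ S) (hx : x ∈ fpvdEdge S p q) :
    dist x p = dist x q :=
  (hx.2 p hp).antisymm (hx.1 q hq)

theorem mem_fpvdCell_of_dist_eq (hx : x ∈ fpvdCell S p) (h : dist x p = dist x q) :
    x ∈ fpvdCell S q :=
  fun r hr => (hx r hr).trans_eq h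

theorem exists_mem_fpvdCell (hS : S.Nonempty) (x : Plane) : ∃ p ∈ S, x ∈ fpvdCell S p :=
  S.exists_max_image (dist x) hS

theorem encloses_through_iff : (Disk.through v p).Encloses S ↔ v ∈ fpvdCell S p :=
  forall₂_congr fun _ _ => sq_le_sq₀ dist_nonneg dist_nonneg

theorem isOptimal_diametral_iff (hp : p ∈ S) (hq : q ∈ S) :
    (Disk.diametral p q).IsOptimal S ↔ midpoint ℝ p q ∈ fpvdCell S p :=
  ⟨fun h => encloses_through_iff.1 h.encloses,
    fun h => ⟨encloses_through_iff.2 h, Disk.isLowerBound_diametral hp hq⟩⟩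

theorem midpoint_mem_fpvdEdge (h : midpoint ℝ p q ∈ fpvdCell S p) :
    midpoint ℝ p q ∈ fpvdEdge S p q :=
  ⟨h, mem_fpvdCell_of_dist_eq h (by rw [dist_midpoint_left, dist_midpoint_right])⟩

theorem exists_mem_segment_inter_fpvdCell (hx : x ∈ fpvdCell S p) (hy : y ∉ fpvdCell S p) :
    ∃ z ∈ segment ℝ x y, z ∈ fpvdCell S p ∧
      ∃ q ∈ S, z ∈ fpvdCell S q ∧ dist y p < dist y q := by
  let others : Set Plane := ⋃ q ∈ {q ∈ S | dist y p < dist y q}, fpvdCell S q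
  have mem_others : ∀ z, z ∈ others ↔ ∃ q ∈ S, z ∈ fpvdCell S q ∧ dist y p < dist y q := by
    intro z
    simp only [others, Set.mem_iUnion, Finset.mem_filter]
    grind
  have isClosed_others : IsClosed others :=
    Set.Finite.isClosed_biUnion (Finset.finite_toSet _) fun q _ => isClosed_fpvdCell S q
  obtain ⟨r, hr, hlt⟩ : ∃ r ∈ S, dist y p < dist y r := by
    simpa only [fpvdCell, Set.mem_ofPred, not_forall, not_le, exists_prop] using hy
  have cover : segment ℝ x y ⊆ fpvdCell S p ∪ others := by
    intro z hz
    obtain ⟨q, hq, hzq⟩ := exists_mem_fpvdCell ⟨r, hr⟩ z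
    by_cases hyq : dist y p < dist y q
    · exact .inr ((mem_others z).2 ⟨q, hq, hzq, hyq⟩)
    · have hle := (convex_setOf_dist_le_dist q p).segment_subset (hx q hq) (not_lt.1 hyq) hz
      exact .inl fun s hs => (hzq s hs).trans hle
  obtain ⟨q, hq, hyq⟩ := exists_mem_fpvdCell ⟨r, hr⟩ y
  obtain ⟨z, hz, hzp, hzo⟩ := isPreconnected_closed_iff.1 (convex_segment x y).isPreconnected
    _ _ (isClosed_fpvdCell S p) isClosed_others cover ⟨x, left_mem_segment ℝ x y, hx⟩
    ⟨y, right_mem_segment ℝ x y, (mem_others y).2 ⟨q, hq, hyq, hlt.trans_le (hyq r hr)⟩⟩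
  exact ⟨z, hz, hzp, (mem_others z).1 hzo⟩

theorem definesVertex_of_mem (hp : p ∈ S) (hq : q ∈ S) (hr : r ∈ S) (hpq : p ≠ q) (hpr : p ≠ r)
    (hqr : q ≠ r) (hvp : v ∈ fpvdCell S p) (hvq : v ∈ fpvdCell S q) (hvr : v ∈ fpvdCell S r) :
    DefinesVertex S p q r v := by
  refine ⟨hp, hq, hr, hpq, hpr, hqr, Set.eq_singleton_iff_unique_mem.2 ⟨⟨⟨hvp, hvq⟩, hvr⟩, ?_⟩⟩
  rintro w ⟨⟨hwp, hwq⟩, hwr⟩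
  exact eq_of_equidistant_of_finrank_eq_two finrank_euclideanSpace_fin hpq hpr hqr
    ⟨dist_eq_of_mem_fpvdEdge hp hq ⟨hwp, hwq⟩, dist_eq_of_mem_fpvdEdge hp hr ⟨hwp, hwr⟩⟩
    ⟨dist_eq_of_mem_fpvdEdge hp hq ⟨hvp, hvq⟩, dist_eq_of_mem_fpvdEdge hp hr ⟨hvp, hvr⟩⟩

theorem exists_definesVertex_mem_segment (hp : p ∈ S) (hq : q ∈ S) (hpq : p ≠ q)
    (hx : x ∈ fpvdEdge S p q) (hy : y ∉ fpvdEdge S p q) (hbis : dist y p = dist y q) :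
    ∃ z ∈ segment ℝ x y, ∃ r, DefinesVertex S p q r z ∧ dist y p < dist y r := by
  have hyp : y ∉ fpvdCell S p := fun h => hy ⟨h, mem_fpvdCell_of_dist_eq h hbis⟩
  obtain ⟨z, hz, hzp, r, hr, hzr, hlt⟩ := exists_mem_segment_inter_fpvdCell hx.1 hyp
  have hle := (convex_setOf_dist_le_dist p q).segment_subset (hx.2 p hp) hbis.le hz
  have hge := (convex_setOf_dist_le_dist q p).segment_subset (hx.1 q hq) hbis.ge hz
  have hzq := mem_fpvdCell_of_dist_eq hzp (hle.antisymm hge)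
  refine ⟨z, hz, r, definesVertex_of_mem hp hq hr hpq ?_ ?_ hzp hzq hzr, hlt⟩
  · rintro rfl
    exact hlt.false
  · rintro rfl
    exact hlt.ne hbis

namespace DefinesVertex

theorem mem_fpvdCell (hv : DefinesVertex S p q r v) :
    v ∈ fpvdCell S p ∧ v ∈ fpvdCell S q ∧ v ∈ fpvdCell S r := by
  obtain ⟨-, -, -, -, -, -, heq⟩ := hv
  obtain ⟨⟨hvp, hvq⟩, hvr⟩ := heq.ge rfl
  exact ⟨hvp, hvq, hvr⟩

theorem mem_fpvdEdge (hv : DefinesVertex S p q r v) : v ∈ fpvdEdge S p q :=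
  ⟨hv.mem_fpvdCell.1, hv.mem_fpvdCell.2.1⟩

theorem dist_eq (hv : DefinesVertex S p q r v) : dist v p = dist v q ∧ dist v p = dist v r := by
  have ⟨hp, hq, hr, _⟩ := hv
  have ⟨hvp, hvq, hvr⟩ := hv.mem_fpvdCell
  exact ⟨dist_eq_of_mem_fpvdEdge hp hq ⟨hvp, hvq⟩, dist_eq_of_mem_fpvdEdge hp hr ⟨hvp, hvr⟩⟩

theorem rotate (hv : DefinesVertex S p q r v) : DefinesVertex S q r p v := by
  obtain ⟨hvp, hvq, hvr⟩ := hv.mem_fpvdCell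
  obtain ⟨hp, hq, hr, hpq, hpr, hqr, -⟩ := hv
  exact definesVertex_of_mem hq hr hp hqr hpq.symm hpr.symm hvq hvr hvp

theorem swap (hv : DefinesVertex S p q r v) : DefinesVertex S q p r v := by
  obtain ⟨hvp, hvq, hvr⟩ := hv.mem_fpvdCell
  obtain ⟨hp, hq, hr, hpq, hpr, hqr, -⟩ := hv
  exact definesVertex_of_mem hq hp hr hpq.symm hqr hpr hvq hvp hvr

theorem encloses_through (hv : DefinesVertex S p q r v) : (Disk.through v p).Encloses S :=
  encloses_through_iff.2 hv.mem_fpvdCell.1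

theorem eq_of_mem_fpvdCell (hS : InGeneralPosition S) (hv : DefinesVertex S p q r v) {s : Plane}
    (hs : s ∈ S) (hvs : v ∈ fpvdCell S s) : s = p ∨ s = q ∨ s = r := by
  classical
  by_contra! hne
  have ⟨hvp, hvq, hvr⟩ := hv.mem_fpvdCell
  have ⟨hp, hq, hr, hpq, hpr, hqr, _⟩ := hv
  refine hS {s, p, q, r} ?_ ?_ ⟨v, dist v s, ?_⟩
  · simp only [Finset.insert_subset_iff, Finset.singleton_subset_iff]
    exact ⟨hs, hp, hq, hr⟩
  · rw [Finset.card_insert_of_notMem (by simp [hne]), Finset.card_insert_of_notMem (by simp [*]),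
      Finset.card_pair hqr]
  · have hdist : ∀ t ∈ S, v ∈ fpvdCell S t → dist t v = dist v s := fun t ht hvt =>
      (dist_comm t v).trans (dist_eq_of_mem_fpvdEdge ht hs ⟨hvt, hvs⟩)
    intro t ht
    simp only [Finset.coe_insert, Finset.coe_singleton, Set.mem_insert_iff,
      Set.mem_singleton_iff] at ht
    rcases ht with rfl | rfl | rfl | rfl
    exacts [hdist _ hs hvs, hdist _ hp hvp, hdist _ hq hvq, hdist _ hr hvr]

end DefinesVertex

end Cells

/-! ### Obtuse triangles -/

section InnerProductSpace

variable {E : Type*} [NormedAddCommGroup E] [InnerProductSpace ℝ E] {v p q r x z : E}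

/-- The angle of the triangle `p q r` at `r` is obtuse. -/
def Obtuse (p q r : E) : Prop :=
  ⟪p - r, q - r⟫ < 0

/-- The cone with apex `v` opposite to the angle `p v q`. The optimal centre lies outside of it if
`p` and `q` are farthest sites of `v`. -/
def oppositeCone (v p q : E) : Set E :=
  {x | ∃ β γ : ℝ, 0 ≤ β ∧ 0 ≤ γ ∧ x - v = -(β • (p - v) + γ • (q - v))}

theorem Obtuse.symm (h : Obtuse p q r) : Obtuse q p r := by
  rwa [Obtuse, real_inner_comm]

theorem oppositeCone_comm (v p q : E) : oppositeCone v p q = oppositeCone v q p := by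
  ext x
  constructor <;> rintro ⟨β, γ, hβ, hγ, h⟩ <;> exact ⟨γ, β, hγ, hβ, by rw [h, add_comm]⟩

theorem dist_midpoint_sq_eq (p q r : E) :
    dist (midpoint ℝ p q) r ^ 2 = dist (midpoint ℝ p q) p ^ 2 + ⟪p - r, q - r⟫ := by
  have hmedian :=
    EuclideanGeometry.dist_sq_add_dist_sq_eq_two_mul_dist_midpoint_sq_add_half_dist_sq r p q
  have hcosine := norm_sub_sq_real (p - r) (q - r)
  rw [sub_sub_sub_cancel_right, ← dist_eq_norm, ← dist_eq_norm, ← dist_eq_norm] at hcosine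
  rw [dist_midpoint_left, Real.norm_ofNat, inv_mul_eq_div, dist_comm _ r]
  rw [dist_comm r p, dist_comm r q] at hmedian
  linarith

theorem Obtuse.dist_midpoint_lt (h : Obtuse p q r) :
    dist (midpoint ℝ p q) r < dist (midpoint ℝ p q) p := by
  rw [← sq_lt_sq₀ dist_nonneg dist_nonneg, dist_midpoint_sq_eq]
  exact add_lt_of_neg_right _ h

theorem dist_sq_eq_of_sub (v p x : E) :
    dist x p ^ 2 = dist v p ^ 2 + dist x v ^ 2 - 2 * ⟪x - v, p - v⟫ := by
  rw [dist_comm v p, dist_eq_norm, dist_eq_norm, dist_eq_norm, ← sub_sub_sub_cancel_right x p v,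
    norm_sub_sq_real]
  ring

theorem add_dist_sq_le_of_inner_nonpos (h : ⟪x - v, p - v⟫ ≤ 0) :
    dist v p ^ 2 + dist x v ^ 2 ≤ dist x p ^ 2 := by
  linarith [dist_sq_eq_of_sub v p x]

theorem inner_nonpos_of_mem_oppositeCone (hx : x ∈ oppositeCone v p q) :
    ⟪x - v, p - v⟫ ≤ 0 ∨ ⟪x - v, q - v⟫ ≤ 0 := by
  obtain ⟨β, γ, hβ, hγ, h⟩ := hx
  by_contra! hpos
  have hself := calc
    ⟪x - v, x - v⟫ = ⟪x - v, -(β • (p - v) + γ • (q - v))⟫ := by rw [← h]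
    _ = -(β * ⟪x - v, p - v⟫ + γ * ⟪x - v, q - v⟫) := by
      rw [inner_neg_right, inner_add_right, real_inner_smul_right, real_inner_smul_right]
    _ ≤ 0 := neg_nonpos.2 (add_nonneg (mul_nonneg hβ hpos.1.le) (mul_nonneg hγ hpos.2.le))
  rw [real_inner_self_nonpos.1 hself, inner_zero_left] at hpos
  exact hpos.1.false

/-- The cell of a farthest site `p` of `v` contains a neighbourhood of the half-line that leaves
`v` in the direction opposite to `p`. -/
theorem eq_of_dist_le_of_sub_eq {β : ℝ} (hβ : 0 < β) (hz : z - v = -(β • (p - v)))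
    (hv : dist v q ≤ dist v p) (hzq : dist z p ≤ dist z q) : q = p := by
  have hexpand : dist z p ^ 2 - dist z q ^ 2 =
      β * dist q p ^ 2 + (1 + β) * (dist v p ^ 2 - dist v q ^ 2) := by
    have hqp : dist q p ^ 2 = ‖q - v‖ ^ 2 - 2 * ⟪q - v, p - v⟫ + ‖p - v‖ ^ 2 := by
      rw [← norm_sub_sq_real, sub_sub_sub_cancel_right, dist_eq_norm]
    rw [dist_sq_eq_of_sub v p z, dist_sq_eq_of_sub v q z, hz, inner_neg_left, inner_neg_left,
      real_inner_smul_left, real_inner_smul_left, real_inner_self_eq_norm_sq, hqp,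
      real_inner_comm (p - v), dist_comm v, dist_comm v, dist_eq_norm, dist_eq_norm q]
    ring
  have hv' := pow_le_pow_left₀ dist_nonneg hv 2
  have hzq' := pow_le_pow_left₀ dist_nonneg hzq 2
  have hqp : β * dist q p ^ 2 ≤ 0 := by nlinarith
  exact dist_eq_zero.1 (pow_eq_zero_iff two_ne_zero |>.1
    ((nonpos_of_mul_nonpos_right hqp hβ).antisymm (sq_nonneg _)))

theorem inner_sub_eq_half_dist_sq (h : dist v p = dist v q) :
    ⟪p - v, p - q⟫ = dist p q ^ 2 / 2 := by
  have hdist := dist_sq_eq_of_sub v p q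
  rw [dist_comm q p, dist_comm q v, ← h] at hdist
  have hself := real_inner_self_eq_norm_sq (p - v)
  rw [← dist_eq_norm, dist_comm] at hself
  rw [← sub_sub_sub_cancel_right p q v, inner_sub_right, hself, real_inner_comm]
  linarith

theorem inner_add_sub_eq_zero (h : dist v p = dist v q) :
    ⟪(p - v) + (q - v), (p - v) - (q - v)⟫ = 0 := by
  rw [real_inner_add_sub_eq_zero_iff, ← dist_eq_norm, ← dist_eq_norm, dist_comm p, dist_comm q, h]

theorem inner_add_sub_eq (h : dist v p = dist v r) :
    ⟪(p - v) + (q - v), p - r⟫ = ⟪p - r, q - r⟫ := by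
  have hrp := inner_add_sub_eq_zero h
  rw [sub_sub_sub_cancel_right] at hrp
  calc
    ⟪(p - v) + (q - v), p - r⟫ = ⟪(p - v) + (r - v), p - r⟫ + ⟪q - r, p - r⟫ := by
      rw [← inner_add_left]
      congr 1
      abel
    _ = ⟪p - r, q - r⟫ := by rw [hrp, zero_add, real_inner_comm]

theorem Obtuse.ne (h : Obtuse p q r) : p ≠ q := by
  rintro rfl
  exact h.not_ge real_inner_self_nonneg

/-- If the triangle `p q r` with circumcentre `v` is obtuse at `r`, the edge of `p` and `r` leaves
`v` into the cone opposite to the longest side. -/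
theorem Obtuse.mem_oppositeCone (ho : Obtuse p q r) (hpq : dist v p = dist v q)
    (hpr : dist v p = dist v r) {β γ : ℝ} (hx : x - v = -(β • (p - v) + γ • (q - v)))
    (hxr : dist x p = dist x r) (hxq : dist x q ≤ dist x p) : x ∈ oppositeCone v p q := by
  have expand : ∀ z, ⟪x - v, z⟫ = -(β * ⟪p - v, z⟫ + γ * ⟪q - v, z⟫) := fun z => by
    rw [hx, inner_neg_left, inner_add_left, real_inner_smul_left, real_inner_smul_left]
  have hβγ : γ ≤ β := by
    have hpos : 0 < dist p q ^ 2 := pow_pos (dist_pos.2 ho.ne) 2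
    have hq := inner_sub_eq_half_dist_sq hpq.symm
    rw [← neg_sub p q, inner_neg_right, dist_comm q p, neg_eq_iff_eq_neg] at hq
    have hle : ⟪x - v, p - q⟫ ≤ 0 := by
      have hsq := pow_le_pow_left₀ dist_nonneg hxq 2
      rw [dist_sq_eq_of_sub v p, dist_sq_eq_of_sub v q, hpq] at hsq
      rw [← sub_sub_sub_cancel_right p q v, inner_sub_right]
      linarith
    rw [expand, inner_sub_eq_half_dist_sq hpq, hq] at hle
    nlinarith
  have hp : 0 ≤ ⟪p - v, p - r⟫ := by
    rw [inner_sub_eq_half_dist_sq hpr]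
    positivity
  have hq : ⟪p - v, p - r⟫ + ⟪q - v, p - r⟫ < 0 := by
    rw [← inner_add_left, inner_add_sub_eq hpr]
    exact ho
  have hzero : β * ⟪p - v, p - r⟫ + γ * ⟪q - v, p - r⟫ = 0 := by
    have hsq := dist_sq_eq_of_sub v p x
    rw [hxr, dist_sq_eq_of_sub v r, hpr] at hsq
    rw [← neg_eq_zero, ← expand, ← sub_sub_sub_cancel_right p r v, inner_sub_right]
    linarith
  have hγ : 0 ≤ γ := by
    by_contra! hneg
    nlinarith
  exact ⟨β, γ, hγ.trans hβγ, hγ, hx⟩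

end InnerProductSpace

/-! ### Triangles in the plane -/

section Plane

variable {S : Finset Plane} {v p q r x y z a b c : Plane}

/-- The determinant of two vectors of the plane, in the coordinates in which the program computes
it. -/
noncomputable def cross (a b : Plane) : ℝ :=
  a 0 * b 1 - a 1 * b 0

theorem inner_plane_eq (a b : Plane) : ⟪a, b⟫ = a 0 * b 0 + a 1 * b 1 := by
  rw [PiLp.inner_apply, Fin.sum_univ_two, Real.inner_apply, Real.inner_apply]

theorem cross_swap (a b : Plane) : cross b a = -cross a b := by
  unfold cross
  ring

theorem cross_smul_eq (a b y : Plane) : cross a b • y = cross y b • a + cross a y • b := by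
  ext i
  fin_cases i <;> simp only [cross, PiLp.smul_apply, PiLp.add_apply, smul_eq_mul] <;> grind

theorem four_mul_cross_sq (h : ‖a‖ = ‖b‖) :
    4 * cross a b ^ 2 = ‖a - b‖ ^ 2 * ‖a + b‖ ^ 2 := by
  have hsq := congrArg (· ^ 2) h
  simp only [← real_inner_self_eq_norm_sq, inner_plane_eq, cross, PiLp.sub_apply,
    PiLp.add_apply] at hsq ⊢
  linear_combination -(a 0 * a 0 + a 1 * a 1 - (b 0 * b 0 + b 1 * b 1)) * hsq

theorem Obtuse.cross_ne_zero (ho : Obtuse p q r) (hpq : dist v p = dist v q)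
    (hpr : dist v p = dist v r) : cross (p - v) (q - v) ≠ 0 := by
  intro hzero
  have hprod := four_mul_cross_sq (a := p - v) (b := q - v)
    (by rw [← dist_eq_norm, ← dist_eq_norm, dist_comm p, dist_comm q, hpq])
  rw [hzero, zero_pow two_ne_zero, mul_zero, eq_comm, mul_eq_zero,
    pow_eq_zero_iff two_ne_zero, pow_eq_zero_iff two_ne_zero, norm_eq_zero, norm_eq_zero,
    sub_sub_sub_cancel_right, sub_eq_zero] at hprod
  refine hprod.elim ho.ne fun hsum => ?_
  have hneg := inner_add_sub_eq (q := q) hpr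
  rw [hsum, inner_zero_left] at hneg
  exact LT.lt.ne ho hneg.symm

theorem cross_smul_add_eq_zero (a b c : Plane) :
    cross b c • a + cross c a • b + cross a b • c = 0 := by
  rw [cross_smul_eq a b c, cross_swap b c, cross_swap a c]
  module

theorem norm_sq_mul_inner_eq (hab : ‖a‖ = ‖b‖) (hac : ‖a‖ = ‖c‖) :
    ‖b - c‖ ^ 2 * ⟪b - a, c - a⟫ = 2 * (cross b c * cross (b - a) (c - a)) := by
  have hb := congrArg (· ^ 2) hab
  have hc := congrArg (· ^ 2) hac
  simp only [← real_inner_self_eq_norm_sq, inner_plane_eq, cross, PiLp.sub_apply] at hb hc ⊢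
  linear_combination
    (c 0 * c 0 + c 1 * c 1 - (b 0 * c 0 + b 1 * c 1) - (a 0 * c 0 + a 1 * c 1) +
      (a 0 * b 0 + a 1 * b 1)) * hb +
    (b 0 * b 0 + b 1 * b 1 - (b 0 * c 0 + b 1 * c 1) + (a 0 * c 0 + a 1 * c 1) -
      (a 0 * b 0 + a 1 * b 1)) * hc

theorem circumcenter_weights_smul_add_eq_zero (hab : ‖a‖ = ‖b‖) (hac : ‖a‖ = ‖c‖) :
    (‖b - c‖ ^ 2 * ⟪b - a, c - a⟫) • a + (‖c - a‖ ^ 2 * ⟪c - b, a - b⟫) • b +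
      (‖a - b‖ ^ 2 * ⟪a - c, b - c⟫) • c = 0 := by
  have cross_sub_rotate : ∀ x y z : Plane, cross (y - x) (z - x) = cross (z - y) (x - y) := by
    intro x y z
    simp only [cross, PiLp.sub_apply]
    ring
  rw [norm_sq_mul_inner_eq hab hac, norm_sq_mul_inner_eq (hab.symm.trans hac) hab.symm,
    norm_sq_mul_inner_eq hac.symm (hac.symm.trans hab), ← cross_sub_rotate b c a,
    ← cross_sub_rotate a b c]
  calc
    _ = (2 * cross (b - a) (c - a)) • (cross b c • a + cross c a • b + cross a b • c) := by module
    _ = 0 := by rw [cross_smul_add_eq_zero, smul_zero]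

/-- The circumcentre of a triangle without obtuse angle is a convex combination of its corners. -/
theorem exists_inner_nonpos_of_not_obtuse (hv : dist v p = dist v q ∧ dist v p = dist v r)
    (hpq : p ≠ q) (hpr : p ≠ r) (hqr : q ≠ r) (hr : ¬Obtuse p q r) (hp : ¬Obtuse q r p)
    (hq : ¬Obtuse r p q) (y : Plane) :
    ⟪y, p - v⟫ ≤ 0 ∨ ⟪y, q - v⟫ ≤ 0 ∨ ⟪y, r - v⟫ ≤ 0 := by
  rw [Obtuse, not_lt] at hp hq hr
  by_contra! hpos
  simp only [dist_eq_norm, norm_sub_rev v] at hv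
  have hsum := congrArg (⟪y, ·⟫) (circumcenter_weights_smul_add_eq_zero hv.1 hv.2)
  simp only [sub_sub_sub_cancel_right, inner_add_right, real_inner_smul_right,
    inner_zero_right] at hsum
  have hwp := mul_nonneg (mul_nonneg (sq_nonneg ‖q - r‖) hp) hpos.1.le
  have hwq := mul_nonneg (mul_nonneg (sq_nonneg ‖r - p‖) hq) hpos.2.1.le
  have hwr := mul_nonneg (mul_nonneg (sq_nonneg ‖p - q‖) hr) hpos.2.2.le
  have angle_p : ⟪q - p, r - p⟫ = 0 := by
    have hzero : ‖q - r‖ ^ 2 * ⟪q - p, r - p⟫ * ⟪y, p - v⟫ = 0 := by linarith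
    simpa [hpos.1.ne', sub_eq_zero, hqr] using hzero
  have angle_q : ⟪r - q, p - q⟫ = 0 := by
    have hzero : ‖r - p‖ ^ 2 * ⟪r - q, p - q⟫ * ⟪y, q - v⟫ = 0 := by linarith
    simpa [hpos.2.1.ne', sub_eq_zero, hpr.symm] using hzero
  have hself : ⟪p - q, p - q⟫ = 0 := calc
    ⟪p - q, p - q⟫ = ⟪r - q, p - q⟫ + ⟪q - p, r - p⟫ := by
      rw [real_inner_comm (r - p), ← neg_sub p q, inner_neg_right, ← sub_eq_add_neg,
        ← inner_sub_left, sub_sub_sub_cancel_left]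
    _ = 0 := by rw [angle_p, angle_q, add_zero]
  exact hpq (sub_eq_zero.1 (inner_self_eq_zero.1 hself))

theorem DefinesVertex.isOptimal_through (hv : DefinesVertex S p q r v) (hr : ¬Obtuse p q r)
    (hp : ¬Obtuse q r p) (hq : ¬Obtuse r p q) : (Disk.through v p).IsOptimal S := by
  refine ⟨hv.encloses_through, fun x => ?_⟩
  have ⟨mp, mq, mr, hpq, hpr, hqr, _⟩ := hv
  have ⟨dpq, dpr⟩ := hv.dist_eq
  rcases exists_inner_nonpos_of_not_obtuse hv.dist_eq hpq hpr hqr hr hp hq (x - v) with h | h | h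
  · exact ⟨p, mp, add_dist_sq_le_of_inner_nonpos h⟩
  · exact ⟨q, mq, by simpa only [Disk.through, dpq] using add_dist_sq_le_of_inner_nonpos h⟩
  · exact ⟨r, mr, by simpa only [Disk.through, dpr] using add_dist_sq_le_of_inner_nonpos h⟩

/-! ### The cone opposite to an angle -/

theorem cross_eq_of_sub_eq {β γ : ℝ} (hx : x - v = -(β • (p - v) + γ • (q - v))) :
    cross (x - v) (q - v) = -(β * cross (p - v) (q - v)) ∧
      cross (p - v) (x - v) = -(γ * cross (p - v) (q - v)) := by
  rw [hx]
  simp only [cross, PiLp.neg_apply, PiLp.add_apply, PiLp.smul_apply, smul_eq_mul]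
  constructor <;> ring

theorem sub_eq_of_cross_ne_zero (h : cross (p - v) (q - v) ≠ 0) (x : Plane) :
    x - v = -((-(cross (x - v) (q - v) / cross (p - v) (q - v))) • (p - v) +
      (-(cross (p - v) (x - v) / cross (p - v) (q - v))) • (q - v)) := by
  rw [neg_smul, neg_smul, ← neg_add, neg_neg, div_eq_inv_mul, div_eq_inv_mul, mul_smul, mul_smul,
    ← smul_add, ← cross_smul_eq, inv_smul_smul₀ h]

theorem mem_oppositeCone_iff (h : cross (p - v) (q - v) ≠ 0) :
    x ∈ oppositeCone v p q ↔ cross (p - v) (q - v) * cross (x - v) (q - v) ≤ 0 ∧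
      cross (p - v) (q - v) * cross (p - v) (x - v) ≤ 0 := by
  constructor
  · rintro ⟨β, γ, hβ, hγ, hx⟩
    obtain ⟨hleft, hright⟩ := cross_eq_of_sub_eq hx
    rw [hleft, hright]
    constructor <;> nlinarith [mul_nonneg hβ (sq_nonneg (cross (p - v) (q - v))),
      mul_nonneg hγ (sq_nonneg (cross (p - v) (q - v)))]
  · rintro ⟨hβ, hγ⟩
    have hdiv : ∀ t, cross (p - v) (q - v) * t ≤ 0 → 0 ≤ -(t / cross (p - v) (q - v)) := by
      intro t ht
      rw [← mul_div_mul_left t _ h, neg_nonneg]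
      exact div_nonpos_of_nonpos_of_nonneg ht (mul_self_nonneg _)
    exact ⟨_, _, hdiv _ hβ, hdiv _ hγ, sub_eq_of_cross_ne_zero h x⟩

theorem eq_of_mem_fpvdEdge_of_sub_eq (hp : p ∈ S) (ha : a ∈ S) (hb : b ∈ S)
    (hv : v ∈ fpvdCell S p) (hz : z ∈ fpvdEdge S a b) (hvab : v ∉ fpvdEdge S a b) {γ : ℝ}
    (hγ : 0 ≤ γ) (hsub : z - v = -(γ • (p - v))) : a = b := by
  rcases hγ.eq_or_lt with rfl | hpos
  · rw [zero_smul, neg_zero, sub_eq_zero] at hsub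
    exact (hvab (hsub ▸ hz)).elim
  · exact (eq_of_dist_le_of_sub_eq hpos hsub (hv a ha) (hz.1 p hp)).trans
      (eq_of_dist_le_of_sub_eq hpos hsub (hv b hb) (hz.2 p hp)).symm

/-- The boundary of the cone consists of two rays opposite to farthest sites of `v`, and an edge
meets such a ray only at `v`. -/
theorem mem_oppositeCone_of_mem_fpvdEdge (hcross : cross (p - v) (q - v) ≠ 0) (hp : p ∈ S)
    (hq : q ∈ S) (hv : v ∈ fpvdEdge S p q) (ha : a ∈ S) (hb : b ∈ S) (hab : a ≠ b)
    (hvab : v ∉ fpvdEdge S a b) (hx : x ∈ fpvdEdge S a b) (hy : y ∈ fpvdEdge S a b)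
    (hcone : y ∈ oppositeCone v p q) : x ∈ oppositeCone v p q := by
  by_contra hout
  let side (z : Plane) : ℝ := max (cross (p - v) (q - v) * cross (z - v) (q - v))
    (cross (p - v) (q - v) * cross (p - v) (z - v))
  have side_nonpos_iff : ∀ z, side z ≤ 0 ↔ z ∈ oppositeCone v p q := fun z => by
    rw [mem_oppositeCone_iff hcross, max_le_iff]
  have continuous_side : Continuous side := by
    simp only [side, cross, PiLp.sub_apply]
    fun_prop
  obtain ⟨z, hz, hside⟩ := (convex_fpvdEdge S a b).isPreconnected.intermediate_value hy hx
    continuous_side.continuousOn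
    ⟨(side_nonpos_iff y).2 hcone, (lt_of_not_ge fun h => hout ((side_nonpos_iff x).1 h)).le⟩
  obtain ⟨β, γ, hβ, hγ, hzv⟩ := (side_nonpos_iff z).1 hside.le
  obtain ⟨hleft, hright⟩ := cross_eq_of_sub_eq hzv
  have hrays : β = 0 ∨ γ = 0 := by
    simp only [side, hleft, hright] at hside
    rcases max_choice (cross (p - v) (q - v) * -(β * cross (p - v) (q - v)))
      (cross (p - v) (q - v) * -(γ * cross (p - v) (q - v))) with h | h <;> rw [h] at hside
    · exact .inl (by simpa [hcross] using hside)
    · exact .inr (by simpa [hcross] using hside)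
  rcases hrays with rfl | rfl
  · rw [zero_smul, zero_add] at hzv
    exact hab (eq_of_mem_fpvdEdge_of_sub_eq hq ha hb hv.2 hz hvab hγ hzv)
  · rw [zero_smul, add_zero] at hzv
    exact hab (eq_of_mem_fpvdEdge_of_sub_eq hp ha hb hv.1 hz hvab hβ hzv)

end Plane

/-! ### Terminal vertices -/

section Terminal

variable {S : Finset Plane} {v w x p q r a b q₁ q₂ q₃ : Plane} {d : Disk Plane}

/-- A vertex at which the search may end: if its triangle is obtuse, the disk on the longest side
is optimal. -/
def Terminal (S : Finset Plane) (v : Plane) : Prop :=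
  ∀ p q r, DefinesVertex S p q r v → Obtuse p q r → (Disk.diametral p q).IsOptimal S

theorem Terminal.exists_isOptimal (ht : Terminal S v) (hv : DefinesVertex S p q r v) :
    ∃ d : Disk Plane, d.IsOptimal S ∧ (d.center = v ∨ ∃ a ∈ S, ∃ b ∈ S, a ≠ b ∧
      d = Disk.diametral a b ∧ v ∈ fpvdEdge S a b) := by
  by_cases ho : ∃ p q r, DefinesVertex S p q r v ∧ Obtuse p q r
  · obtain ⟨p, q, r, hv, ho⟩ := ho
    have ⟨hp, hq, _, hpq, _⟩ := hv
    exact ⟨_, ht p q r hv ho, .inr ⟨p, hp, q, hq, hpq, rfl, hv.mem_fpvdEdge⟩⟩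
  · push Not at ho
    exact ⟨_, hv.isOptimal_through (ho _ _ _ hv) (ho _ _ _ hv.rotate)
      (ho _ _ _ hv.rotate.rotate), .inl rfl⟩

namespace DefinesVertex

theorem exists_definesVertex_dist_lt (hS : InGeneralPosition S) (hv : DefinesVertex S p q r v)
    (ho : Obtuse p q r) (hn : ¬(Disk.diametral p q).IsOptimal S) :
    ∃ z s, DefinesVertex S p q s z ∧ z ≠ v ∧ dist z p < dist v p := by
  have ⟨hp, hq, _, hpq, _⟩ := hv
  have hbis : dist (midpoint ℝ p q) p = dist (midpoint ℝ p q) q := by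
    rw [dist_midpoint_left, dist_midpoint_right]
  obtain ⟨z, hz, s, hzs, hlt⟩ := exists_definesVertex_mem_segment hp hq hpq hv.mem_fpvdEdge
    (fun h => hn ((isOptimal_diametral_iff hp hq).2 h.1)) hbis
  have hne : z ≠ v := by
    rintro rfl
    rcases hv.eq_of_mem_fpvdCell hS hzs.2.2.1 hzs.mem_fpvdCell.2.2 with rfl | rfl | rfl
    exacts [hlt.false, hlt.ne hbis, hlt.asymm ho.dist_midpoint_lt]
  have hsum := (mem_segment_iff_wbtw.1 hz).dist_add_dist
  have hcloser : dist z (midpoint ℝ p q) < dist v (midpoint ℝ p q) := by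
    linarith [dist_pos.2 hne.symm]
  refine ⟨z, s, hzs, hne, ?_⟩
  rw [← sq_lt_sq₀ dist_nonneg dist_nonneg, dist_sq_eq_dist_midpoint_sq_add hzs.dist_eq.1,
    dist_sq_eq_dist_midpoint_sq_add hv.dist_eq.1]
  gcongr

theorem center_eq_or_notMem_oppositeCone (hv : DefinesVertex S p q r v) (hd : d.IsOptimal S) :
    d.center = v ∨ d.center ∉ oppositeCone v p q := by
  refine or_iff_not_imp_left.2 fun hne hcone => ?_
  have hlower : d.sqRadius + dist v d.center ^ 2 ≤ dist v p ^ 2 :=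
    hd.isLowerBound.sqRadius_add_le (d' := .through v p) hv.encloses_through
  have hupper : dist v p ^ 2 + dist d.center v ^ 2 ≤ d.sqRadius := by
    rcases inner_nonpos_of_mem_oppositeCone hcone with hp | hq
    · exact (add_dist_sq_le_of_inner_nonpos hp).trans (hd.encloses p hv.1)
    · rw [hv.dist_eq.1]
      exact (add_dist_sq_le_of_inner_nonpos hq).trans (hd.encloses q hv.2.1)
  have hpos : 0 < dist d.center v ^ 2 := pow_pos (dist_pos.2 hne) 2
  rw [dist_comm v d.center] at hlower
  linarith

theorem center_ne_of_obtuse (hS : InGeneralPosition S) (hv : DefinesVertex S p q r v)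
    (ho : Obtuse p q r) (hd : d.IsOptimal S) : d.center ≠ v := by
  rintro rfl
  by_cases hn : (Disk.diametral p q).IsOptimal S
  · have hcenter : d.center = midpoint ℝ p q := congrArg Disk.center (hd.eq hn)
    have hlt := ho.dist_midpoint_lt
    rw [← hcenter] at hlt
    exact hlt.ne' hv.dist_eq.2
  · obtain ⟨z, s, hz, -, hlt⟩ := hv.exists_definesVertex_dist_lt hS ho hn
    have hle : d.sqRadius ≤ dist z p ^ 2 := hd.isLowerBound.sqRadius_le hz.encloses_through
    exact hlt.not_ge ((sq_le_sq₀ dist_nonneg dist_nonneg).1 ((hd.encloses p hv.1).trans hle))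

theorem mem_oppositeCone_of_obtuse (hv : DefinesVertex S p q r v) (ho : Obtuse p q r)
    (hx : x ∈ fpvdEdge S p r) : x ∈ oppositeCone v p q :=
  have ⟨hp, hq, hr, _⟩ := hv
  ho.mem_oppositeCone hv.dist_eq.1 hv.dist_eq.2
    (sub_eq_of_cross_ne_zero (ho.cross_ne_zero hv.dist_eq.1 hv.dist_eq.2) x)
    (dist_eq_of_mem_fpvdEdge hp hr hx) (hx.1 q hq)

theorem sym2_eq_of_notMem_oppositeCone (hS : InGeneralPosition S) (hv : DefinesVertex S p q r v)
    (ho : Obtuse p q r) (ha : a ∈ S) (hb : b ∈ S) (hab : a ≠ b) (hvab : v ∈ fpvdEdge S a b)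
    (hx : x ∈ fpvdEdge S a b) (hout : x ∉ oppositeCone v p q) : s(a, b) = s(p, q) := by
  have hpr : x ∉ fpvdEdge S p r := fun h => hout (hv.mem_oppositeCone_of_obtuse ho h)
  have hqr : x ∉ fpvdEdge S q r := fun h =>
    hout (oppositeCone_comm v p q ▸ hv.swap.mem_oppositeCone_of_obtuse ho.symm h)
  have hba := fpvdEdge_comm S a b ▸ hx
  rcases hv.eq_of_mem_fpvdCell hS ha hvab.1 with rfl | rfl | rfl <;>
  rcases hv.eq_of_mem_fpvdCell hS hb hvab.2 with rfl | rfl | rfl <;>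
  first
  | exact (hab rfl).elim
  | exact (hpr ‹_›).elim
  | exact (hqr ‹_›).elim
  | rfl
  | exact Sym2.eq_swap

end DefinesVertex

theorem Terminal.notMem_oppositeCone (hS : InGeneralPosition S) (hv : DefinesVertex S p q r v)
    (ho : Obtuse p q r) (hn : ¬(Disk.diametral p q).IsOptimal S)
    (hw : DefinesVertex S q₁ q₂ q₃ w) (ht : Terminal S w) : w ∉ oppositeCone v p q := by
  obtain ⟨d, hd, hdw⟩ := ht.exists_isOptimal hw
  have hout : d.center ∉ oppositeCone v p q :=
    (hv.center_eq_or_notMem_oppositeCone hd).resolve_left (hv.center_ne_of_obtuse hS ho hd)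
  rcases hdw with rfl | ⟨a, ha, b, hb, hab, rfl, hwab⟩
  · exact hout
  have hmid : midpoint ℝ a b ∈ fpvdEdge S a b :=
    midpoint_mem_fpvdEdge ((isOptimal_diametral_iff ha hb).1 hd)
  by_cases hvab : v ∈ fpvdEdge S a b
  · rcases Sym2.eq_iff.1 (hv.sym2_eq_of_notMem_oppositeCone hS ho ha hb hab hvab hmid hout)
      with ⟨rfl, rfl⟩ | ⟨rfl, rfl⟩
    · exact (hn hd).elim
    · exact (hn (Disk.diametral_comm a b ▸ hd)).elim
  · exact fun h => hout (mem_oppositeCone_of_mem_fpvdEdge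
      (ho.cross_ne_zero hv.dist_eq.1 hv.dist_eq.2) hv.1 hv.2.1 hv.mem_fpvdEdge ha hb hab hvab
      hmid hwab h)

end Terminal

/-! ### The tree of vertices and bounded edges -/

theorem exists_ne_midpoint_dist_eq {p q : Plane} (hpq : p ≠ q) :
    ∃ x, x ≠ midpoint ℝ p q ∧ dist x p = dist x q := by
  let u : Plane := !₂[-(q - p) 1, (q - p) 0]
  have hu : u ≠ 0 := fun h => hpq.symm <| sub_eq_zero.1 <| by
    have h₀ : -(q - p) 1 = 0 := congrArg (· 0) h
    have h₁ : (q - p) 0 = 0 := congrArg (· 1) h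
    ext i
    fin_cases i
    exacts [h₁, neg_eq_zero.1 h₀]
  have horth : inner ℝ u (q - p) = 0 := by
    rw [inner_plane_eq]
    change -(q - p) 1 * (q - p) 0 + (q - p) 0 * (q - p) 1 = 0
    ring
  refine ⟨u +ᵥ midpoint ℝ p q, by rwa [ne_eq, vadd_eq_add, add_eq_right], ?_⟩
  rw [← AffineSubspace.mem_perpBisector_iff_dist_eq,
    AffineSubspace.mem_perpBisector_iff_inner_eq_zero, vadd_vsub, vsub_eq_sub, horth]

namespace DiagramTables.IsFPVD

variable {D : DiagramTables} {S : Finset Plane} {i j k : Fin D.numVertices} {a b p q v : Plane}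

theorem exists_edgeSet_eq (hD : D.IsFPVD S) (hab : DefinesEdge S a b) :
    ∃ e, D.edgeSet S e = fpvdEdge S a b := by
  obtain ⟨e, he, -⟩ := hD.edge_complete a b hab
  refine ⟨e, ?_⟩
  rcases Sym2.eq_iff.1 he with ⟨h₀, h₁⟩ | ⟨h₀, h₁⟩
  · rw [edgeSet, h₀, h₁, fpvdEdge]
  · rw [edgeSet, h₀, h₁, fpvdEdge_comm, fpvdEdge]

theorem adj_of_mem_fpvdEdge (hD : D.IsFPVD S) (ha : a ∈ S) (hb : b ∈ S) (hab : a ≠ b)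
    (hij : i ≠ j) (hi : D.vertex i ∈ fpvdEdge S a b) (hj : D.vertex j ∈ fpvdEdge S a b) :
    D.graph.Adj i j := by
  obtain ⟨e, he⟩ :=
    hD.exists_edgeSet_eq ⟨ha, hb, hab, _, hi, _, hj, hD.vertex_injective.ne hij⟩
  exact ⟨hij, e, (hD.edgeEnd_spec e i).2 (he ▸ hi), (hD.edgeEnd_spec e j).2 (he ▸ hj)⟩

theorem reachable_of_mem_fpvdEdge (hD : D.IsFPVD S) (ha : a ∈ S) (hb : b ∈ S) (hab : a ≠ b)
    (hi : D.vertex i ∈ fpvdEdge S a b) (hj : D.vertex j ∈ fpvdEdge S a b) :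
    D.graph.Reachable i j := by
  by_cases hij : i = j
  · rw [hij]
  · exact (hD.adj_of_mem_fpvdEdge ha hb hab hij hi hj).reachable

theorem exists_fpvdEdge_of_adj (hD : D.IsFPVD S) (h : D.graph.Adj i j) :
    ∃ a ∈ S, ∃ b ∈ S, a ≠ b ∧ D.vertex i ∈ fpvdEdge S a b ∧ D.vertex j ∈ fpvdEdge S a b := by
  obtain ⟨-, e, hi, hj⟩ := h
  obtain ⟨ha, hb, hab, -⟩ := hD.edgeSite_spec e
  exact ⟨_, ha, _, hb, hab, (hD.edgeEnd_spec e i).1 hi, (hD.edgeEnd_spec e j).1 hj⟩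

/-- An edge has only two table entries for its end vertices. -/
theorem eq_or_eq_or_eq_of_mem_fpvdEdge (hD : D.IsFPVD S) (ha : a ∈ S) (hb : b ∈ S) (hab : a ≠ b)
    (hi : D.vertex i ∈ fpvdEdge S a b) (hj : D.vertex j ∈ fpvdEdge S a b)
    (hk : D.vertex k ∈ fpvdEdge S a b) : i = j ∨ i = k ∨ j = k := by
  by_contra! hne
  obtain ⟨e, he⟩ :=
    hD.exists_edgeSet_eq ⟨ha, hb, hab, _, hi, _, hj, hD.vertex_injective.ne hne.1⟩
  obtain ⟨x, hx⟩ := (hD.edgeEnd_spec e i).2 (he ▸ hi)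
  obtain ⟨y, hy⟩ := (hD.edgeEnd_spec e j).2 (he ▸ hj)
  obtain ⟨z, hz⟩ := (hD.edgeEnd_spec e k).2 (he ▸ hk)
  obtain rfl | rfl | rfl : x = y ∨ x = z ∨ y = z := by omega
  exacts [hne.1 (Option.some.inj (hx.symm.trans hy)),
    hne.2.1 (Option.some.inj (hx.symm.trans hz)), hne.2.2 (Option.some.inj (hy.symm.trans hz))]

theorem exists_vertex_eq {r : Plane} (hD : D.IsFPVD S) (hv : DefinesVertex S p q r v) :
    ∃ j, D.vertex j = v :=
  hD.vertex_range.ge ⟨p, q, r, hv⟩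

theorem dist_vertexSite (hD : D.IsFPVD S) (hp : p ∈ S) (hj : D.vertex j ∈ fpvdCell S p) :
    dist (D.vertex j) (D.site (D.vertexSite j 0)) = dist (D.vertex j) p :=
  dist_eq_of_mem_fpvdEdge (hD.vertexSite_spec j).1 hp ⟨(hD.vertexSite_spec j).mem_fpvdCell.1, hj⟩

theorem exists_adj_dist_lt (hD : D.IsFPVD S) (hS : InGeneralPosition S)
    (hj : ¬Terminal S (D.vertex j)) : ∃ k, D.graph.Adj j k ∧
      dist (D.vertex k) (D.site (D.vertexSite k 0)) <
        dist (D.vertex j) (D.site (D.vertexSite j 0)) := by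
  unfold Terminal at hj
  push Not at hj
  obtain ⟨p, q, r, hv, ho, hn⟩ := hj
  obtain ⟨z, s, hz, hne, hlt⟩ := hv.exists_definesVertex_dist_lt hS ho hn
  obtain ⟨k, rfl⟩ := hD.exists_vertex_eq hz
  have ⟨hp, hq, _, hpq, _⟩ := hv
  refine ⟨k, hD.adj_of_mem_fpvdEdge hp hq hpq (fun h => hne (h ▸ rfl)) hv.mem_fpvdEdge
    hz.mem_fpvdEdge, ?_⟩
  rwa [hD.dist_vertexSite hp hv.mem_fpvdCell.1, hD.dist_vertexSite hp hz.mem_fpvdCell.1]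

theorem exists_reachable_terminal (hD : D.IsFPVD S) (hS : InGeneralPosition S)
    (j : Fin D.numVertices) : ∃ k, Terminal S (D.vertex k) ∧ D.graph.Reachable j k := by
  obtain ⟨k, hk, hmin⟩ := Set.exists_min_image {k | D.graph.Reachable j k}
    (fun k => dist (D.vertex k) (D.site (D.vertexSite k 0))) (Set.toFinite _) ⟨j, .refl j⟩
  refine ⟨k, by_contra fun hn => ?_, hk⟩
  obtain ⟨l, hkl, hlt⟩ := hD.exists_adj_dist_lt hS hn
  exact (hmin l (hk.trans hkl.reachable)).not_gt hlt

theorem reachable_of_terminal (hD : D.IsFPVD S) (hi : Terminal S (D.vertex i))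
    (hj : Terminal S (D.vertex j)) : D.graph.Reachable i j := by
  obtain ⟨d, hd, hdi⟩ := hi.exists_isOptimal (hD.vertexSite_spec i)
  obtain ⟨d', hd', hdj⟩ := hj.exists_isOptimal (hD.vertexSite_spec j)
  obtain rfl := hd.eq hd'
  have hcenter {a b} (ha : a ∈ S) (hb : b ∈ S) (h : d = Disk.diametral a b) :
      d.center ∈ fpvdEdge S a b := by
    subst h
    exact midpoint_mem_fpvdEdge ((isOptimal_diametral_iff ha hb).1 hd)
  rcases hdi with hdi | ⟨a, ha, b, hb, hab, rfl, hia⟩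
  · rcases hdj with hdj | ⟨a, ha, b, hb, hab, hd, hja⟩
    · rw [hD.vertex_injective (hdi.symm.trans hdj)]
    · exact hD.reachable_of_mem_fpvdEdge ha hb hab (hdi ▸ hcenter ha hb hd) hja
  rcases hdj with hdj | ⟨a', ha', b', hb', hab', hd, hja⟩
  · exact hD.reachable_of_mem_fpvdEdge ha hb hab hia (hdj ▸ hcenter ha hb rfl)
  have hca := hcenter ha hb rfl
  have hca' := hcenter ha' hb' hd
  by_cases hs : s(a', b') = s(a, b)
  · have hedge : fpvdEdge S a' b' = fpvdEdge S a b := by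
      rcases Sym2.eq_iff.1 hs with ⟨rfl, rfl⟩ | ⟨rfl, rfl⟩
      exacts [rfl, fpvdEdge_comm S _ _]
    exact hD.reachable_of_mem_fpvdEdge ha hb hab hia (hedge ▸ hja)
  · obtain ⟨c, hc, hcc, hac, hbc⟩ :
        ∃ c ∈ S, (Disk.diametral a b).center ∈ fpvdCell S c ∧ a ≠ c ∧ b ≠ c := by
      by_contra! h
      have ha'_eq := h a' ha' hca'.1
      have hb'_eq := h b' hb' hca'.2
      grind
    obtain ⟨k, hk⟩ :=
      hD.exists_vertex_eq (definesVertex_of_mem ha hb hc hab hac hbc hca.1 hca.2 hcc)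
    rw [← hk] at hca hca'
    exact (hD.reachable_of_mem_fpvdEdge ha hb hab hia hca).trans
      (hD.reachable_of_mem_fpvdEdge ha' hb' hab' hca' hja)

theorem preconnected_graph (hD : D.IsFPVD S) (hS : InGeneralPosition S) :
    D.graph.Preconnected := by
  intro i j
  obtain ⟨i', hi', hii'⟩ := hD.exists_reachable_terminal hS i
  obtain ⟨j', hj', hjj'⟩ := hD.exists_reachable_terminal hS j
  exact (hii'.trans (hD.reachable_of_terminal hi' hj')).trans hjj'.symm

theorem mem_fpvdEdge_of_isEmpty (hD : D.IsFPVD S) (hV : IsEmpty (Fin D.numVertices)) {x y : Plane}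
    (ha : a ∈ S) (hb : b ∈ S) (hab : a ≠ b) (hx : x ∈ fpvdEdge S a b)
    (hy : dist y a = dist y b) : y ∈ fpvdEdge S a b := by
  by_contra hn
  obtain ⟨z, -, r, hz, -⟩ := exists_definesVertex_mem_segment ha hb hab hx hn hy
  exact hV.elim (hD.exists_vertex_eq hz).choose

theorem numEdges_pos_of_isEmpty (hD : D.IsFPVD S) (hV : IsEmpty (Fin D.numVertices))
    (hp : p ∈ S) (hq : q ∈ S) (hpq : p ≠ q) : 0 < D.numEdges := by
  obtain ⟨a, ha, hpa⟩ := exists_mem_fpvdCell ⟨p, hp⟩ p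
  have haa : a ∉ fpvdCell S a := fun h => hpq <| by
    have heq : ∀ s ∈ S, s = a := fun s hs => (dist_le_zero.1 ((h s hs).trans_eq (dist_self a))).symm
    rw [heq p hp, heq q hq]
  obtain ⟨z, -, hza, b, hb, hzb, hlt⟩ := exists_mem_segment_inter_fpvdCell hpa haa
  have hab : a ≠ b := fun h => hlt.ne (h ▸ rfl)
  obtain ⟨x, hx, hxab⟩ := exists_ne_midpoint_dist_eq hab
  obtain ⟨e, -⟩ := hD.exists_edgeSet_eq ⟨ha, hb, hab, x,
    hD.mem_fpvdEdge_of_isEmpty hV ha hb hab ⟨hza, hzb⟩ hxab, midpoint ℝ a b,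
    hD.mem_fpvdEdge_of_isEmpty hV ha hb hab ⟨hza, hzb⟩
      (by rw [dist_midpoint_left, dist_midpoint_right]), hx⟩
  exact e.pos

end DiagramTables.IsFPVD

/-! ### Pieces that remain when a vertex is removed -/

section Pieces

variable {V : Type*} {G : SimpleGraph V} {A B C C' : Set V} {v x y : V}

theorem exists_adj_of_preconnected_induce (hA : (G.induce A).Preconnected) (hx : x ∈ A)
    (hy : y ∈ A) (hxB : x ∈ B) (hyB : y ∉ B) : ∃ a ∈ A, ∃ b ∈ A, a ∈ B ∧ b ∉ B ∧ G.Adj a b := by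
  obtain ⟨walk⟩ := hA ⟨x, hx⟩ ⟨y, hy⟩
  obtain ⟨e, -, he, he'⟩ := walk.exists_boundary_dart (Subtype.val ⁻¹' B) hxB hyB
  exact ⟨e.fst, e.fst.2, e.snd, e.snd.2, he, he', e.adj⟩

theorem exists_mem_piecesAfterRemoval (hx : x ∈ A \ {v}) :
    ∃ C ∈ piecesAfterRemoval G A v, x ∈ C :=
  ⟨_, ⟨(G.induce _).connectedComponentMk ⟨x, hx⟩, rfl⟩, ⟨x, hx⟩, rfl, rfl⟩

theorem mem_diff_of_mem_piecesAfterRemoval (hC : C ∈ piecesAfterRemoval G A v) (hx : x ∈ C) :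
    x ∈ A \ {v} := by
  obtain ⟨c, rfl⟩ := hC
  obtain ⟨x, -, rfl⟩ := hx
  exact x.2

theorem mem_of_adj_of_mem_piecesAfterRemoval (hC : C ∈ piecesAfterRemoval G A v) (hx : x ∈ C)
    (hy : y ∈ A \ {v}) (h : G.Adj x y) : y ∈ C := by
  obtain ⟨c, rfl⟩ := hC
  obtain ⟨x, hx, rfl⟩ := hx
  exact ⟨⟨y, hy⟩, c.mem_supp_of_adj_mem_supp hx h, rfl⟩

theorem eq_of_mem_piecesAfterRemoval (hC : C ∈ piecesAfterRemoval G A v)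
    (hC' : C' ∈ piecesAfterRemoval G A v) (hx : x ∈ C) (hx' : x ∈ C') : C = C' := by
  obtain ⟨c, rfl⟩ := hC
  obtain ⟨c', rfl⟩ := hC'
  obtain ⟨x, hx, rfl⟩ := hx
  obtain ⟨y, hy, hyx⟩ := hx'
  obtain rfl := Subtype.val_injective hyx
  rw [← hx, ← hy]

theorem preconnected_induce_of_mem_piecesAfterRemoval (hC : C ∈ piecesAfterRemoval G A v) :
    (G.induce C).Preconnected := by
  obtain ⟨c, rfl⟩ := hC
  rintro ⟨_, x, hx, rfl⟩ ⟨_, y, hy, rfl⟩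
  let toPiece : c.toSimpleGraph →g G.induce (Subtype.val '' c.supp) :=
    ⟨fun z => ⟨z, z, z.2, rfl⟩, fun h => h⟩
  exact (c.reachable_toSimpleGraph hx hy).map toPiece

theorem exists_adj_of_mem_piecesAfterRemoval (hA : (G.induce A).Preconnected) (hv : v ∈ A)
    (hC : C ∈ piecesAfterRemoval G A v) (hx : x ∈ C) : ∃ y ∈ C, G.Adj y v := by
  have hvC : v ∉ C := fun h => (mem_diff_of_mem_piecesAfterRemoval hC h).2 rfl
  obtain ⟨a, -, b, hb, haC, hbC, hab⟩ := exists_adj_of_preconnected_induce hA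
    (mem_diff_of_mem_piecesAfterRemoval hC hx).1 hv hx hvC
  obtain rfl : b = v :=
    by_contra fun hbv => hbC (mem_of_adj_of_mem_piecesAfterRemoval hC haC ⟨hb, hbv⟩ hab)
  exact ⟨a, haC, hab⟩

end Pieces

/-! ### The search -/

namespace DiagramTables.IsFPVD

variable {D : DiagramTables} {S : Finset Plane} {A C C' : Set (Fin D.numVertices)}
  {v x y : Fin D.numVertices} {p q r : Plane}

theorem notMem_oppositeCone_of_mem_piecesAfterRemoval (hD : D.IsFPVD S)
    (hv : DefinesVertex S p q r (D.vertex v)) (ho : Obtuse p q r)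
    (hC : C ∈ piecesAfterRemoval D.graph A v) (hx : x ∈ C) (hy : y ∈ C)
    (hout : D.vertex x ∉ oppositeCone (D.vertex v) p q) :
    D.vertex y ∉ oppositeCone (D.vertex v) p q := by
  intro hcone
  obtain ⟨i, hi, j, hj, hiout, hjcone, hij⟩ := exists_adj_of_preconnected_induce
    (B := {x | D.vertex x ∉ oppositeCone (D.vertex v) p q})
    (preconnected_induce_of_mem_piecesAfterRemoval hC) hx hy hout (not_not.2 hcone)
  obtain ⟨a, ha, b, hb, hab, hia, hja⟩ := hD.exists_fpvdEdge_of_adj hij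
  refine hiout (mem_oppositeCone_of_mem_fpvdEdge (ho.cross_ne_zero hv.dist_eq.1 hv.dist_eq.2)
    hv.1 hv.2.1 hv.mem_fpvdEdge ha hb hab (fun hva => ?_) hia hja (not_not.1 hjcone))
  rcases hD.eq_or_eq_or_eq_of_mem_fpvdEdge ha hb hab hia hja hva with rfl | rfl | rfl
  exacts [hij.ne rfl, (mem_diff_of_mem_piecesAfterRemoval hC hi).2 rfl,
    (mem_diff_of_mem_piecesAfterRemoval hC hj).2 rfl]

/-- The only edge at `v` that leaves the cone is the one of `p` and `q`. -/
theorem eq_of_notMem_oppositeCone (hD : D.IsFPVD S) (hS : InGeneralPosition S)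
    (hA : (D.graph.induce A).Preconnected) (hvA : v ∈ A)
    (hv : DefinesVertex S p q r (D.vertex v)) (ho : Obtuse p q r)
    (hC : C ∈ piecesAfterRemoval D.graph A v) (hC' : C' ∈ piecesAfterRemoval D.graph A v)
    (hx : x ∈ C) (hy : y ∈ C') (hxout : D.vertex x ∉ oppositeCone (D.vertex v) p q)
    (hyout : D.vertex y ∉ oppositeCone (D.vertex v) p q) : C = C' := by
  have hneighbour {B z} (hB : B ∈ piecesAfterRemoval D.graph A v) (hz : z ∈ B)
      (hzout : D.vertex z ∉ oppositeCone (D.vertex v) p q) :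
      ∃ w ∈ B, w ≠ v ∧ D.vertex w ∈ fpvdEdge S p q := by
    obtain ⟨w, hwB, hwv⟩ := exists_adj_of_mem_piecesAfterRemoval hA hvA hB hz
    have hwout := hD.notMem_oppositeCone_of_mem_piecesAfterRemoval hv ho hB hz hwB hzout
    obtain ⟨a, ha, b, hb, hab, hwa, hva⟩ := hD.exists_fpvdEdge_of_adj hwv
    refine ⟨w, hwB, hwv.ne, ?_⟩
    rcases Sym2.eq_iff.1 (hv.sym2_eq_of_notMem_oppositeCone hS ho ha hb hab hva hwa hwout)
      with ⟨rfl, rfl⟩ | ⟨rfl, rfl⟩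
    exacts [hwa, fpvdEdge_comm S _ _ ▸ hwa]
  obtain ⟨x', hx', hx'v, hx'e⟩ := hneighbour hC hx hxout
  obtain ⟨y', hy', hy'v, hy'e⟩ := hneighbour hC' hy hyout
  have heq := hD.eq_or_eq_or_eq_of_mem_fpvdEdge hv.1 hv.2.1 hv.2.2.2.1 hx'e hy'e hv.mem_fpvdEdge
  obtain rfl := (heq.resolve_right (not_or.2 ⟨hx'v, hy'v⟩))
  exact eq_of_mem_piecesAfterRemoval hC hC' hx' hy'

end DiagramTables.IsFPVD

section Search

variable {D : DiagramTables} {S : Finset Plane} {A : Set (Fin D.numVertices)}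
  {child : Fin D.numVertices → Fin 3 → Option (Fin D.numVertices)} {v w : Fin D.numVertices}
  {d d' : Disk Plane} {next : Option (Fin D.numVertices)}

/-- A visit of the vertex `v` finds a disk and moves on to a child of `v`, or ends the search. -/
inductive Visit (D : DiagramTables) (S : Finset Plane)
    (child : Fin D.numVertices → Fin 3 → Option (Fin D.numVertices)) (v : Fin D.numVertices) :
    Disk Plane → Option (Fin D.numVertices) → Prop
  | optimal {d : Disk Plane} (hd : d.IsOptimal S) : Visit D S child v d none
  | descend {p q r : Plane} {i : Fin 3} {w : Fin D.numVertices}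
      (hv : DefinesVertex S p q r (D.vertex v)) (ho : Obtuse p q r) (hw : child v i = some w)
      (hout : D.vertex w ∉ oppositeCone (D.vertex v) p q) :
      Visit D S child v (Disk.diametral p q) (some w)
  | stuck {p q r : Plane} (hv : DefinesVertex S p q r (D.vertex v)) (ho : Obtuse p q r)
      (hin : ∀ i w, child v i = some w → D.vertex w ∈ oppositeCone (D.vertex v) p q) :
      Visit D S child v (Disk.diametral p q) none

/-- The invariant of the search in the subtree with vertex set `A`, where `d` is the largest disk
found so far. -/
structure SearchInvariant (D : DiagramTables) (S : Finset Plane) (A : Set (Fin D.numVertices))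
    (d : Disk Plane) : Prop where
  isLowerBound : d.IsLowerBound S
  isOptimal_or : d.IsOptimal S ∨
    (D.graph.induce A).Preconnected ∧ ∃ j ∈ A, Terminal S (D.vertex j)

theorem Visit.isLowerBound (h : Visit D S child v d next) : d.IsLowerBound S := by
  cases h with
  | optimal hd => exact hd.isLowerBound
  | descend hv => exact Disk.isLowerBound_diametral hv.1 hv.2.1
  | stuck hv => exact Disk.isLowerBound_diametral hv.1 hv.2.1

theorem DiagramTables.IsFPVD.exists_piece_of_terminal {p q r : Plane} {j : Fin D.numVertices}
    (hD : D.IsFPVD S) (hS : InGeneralPosition S)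
    (hv : DefinesVertex S p q r (D.vertex v)) (ho : Obtuse p q r)
    (hn : ¬(Disk.diametral p q).IsOptimal S) (hj : j ∈ A) (ht : Terminal S (D.vertex j)) :
    ∃ C ∈ piecesAfterRemoval D.graph A v, j ∈ C ∧
      D.vertex j ∉ oppositeCone (D.vertex v) p q := by
  have hjv : j ≠ v := by
    rintro rfl
    exact hn (ht p q r hv ho)
  obtain ⟨C, hC, hjC⟩ := exists_mem_piecesAfterRemoval (G := D.graph) ⟨hj, hjv⟩
  exact ⟨C, hC, hjC, ht.notMem_oppositeCone hS hv ho hn (hD.vertexSite_spec j)⟩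

theorem SearchInvariant.isOptimal_larger (hinv : SearchInvariant D S A d) (hD : D.IsFPVD S)
    (hS : InGeneralPosition S) (hA : IsCentroidTree D.graph child A v)
    (h : Visit D S child v d' none) : (d.larger d').IsOptimal S := by
  have hd' := h.isLowerBound
  refine hinv.isLowerBound.isOptimal_larger hd' (or_iff_not_imp_left.2 fun hd => ?_)
  cases h with
  | optimal hd' => exact hd'
  | stuck hv ho hin =>
    by_contra hn
    obtain ⟨-, j, hj, ht⟩ := hinv.isOptimal_or.resolve_left hd
    obtain ⟨C, hC, hjC, hjout⟩ := hD.exists_piece_of_terminal hS hv ho hn hj ht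
    obtain ⟨_, _, _, _, _, one_child, _⟩ := hA
    obtain ⟨i, ⟨w, hwC, hw⟩, -⟩ := one_child C hC
    exact hD.notMem_oppositeCone_of_mem_piecesAfterRemoval hv ho hC hjC hwC hjout (hin i w hw)

theorem SearchInvariant.exists_piece (hinv : SearchInvariant D S A d) (hD : D.IsFPVD S)
    (hS : InGeneralPosition S) (hA : IsCentroidTree D.graph child A v)
    (h : Visit D S child v d' (some w)) : ∃ C : Set (Fin D.numVertices),
      2 * C.ncard ≤ A.ncard ∧ IsCentroidTree D.graph child C w ∧
        SearchInvariant D S C (d.larger d') := by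
  have hd' := h.isLowerBound
  have hlarger := hinv.isLowerBound.larger hd'
  obtain ⟨A, v, hvA, half, child_mem, _, sub⟩ := hA
  cases h with
  | @descend p q r i _ hv ho hw hout =>
    obtain ⟨C, hC, hwC⟩ := exists_mem_piecesAfterRemoval (G := D.graph) (child_mem i w hw)
    refine ⟨C, half C hC, sub C hC i w hwC hw, hlarger, ?_⟩
    by_cases hopt : d.IsOptimal S ∨ (Disk.diametral p q).IsOptimal S
    · exact .inl (hinv.isLowerBound.isOptimal_larger hd' hopt)
    obtain ⟨hd, hn⟩ := not_or.1 hopt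
    obtain ⟨hA, j, hj, ht⟩ := hinv.isOptimal_or.resolve_left hd
    obtain ⟨C', hC', hjC', hjout⟩ := hD.exists_piece_of_terminal hS hv ho hn hj ht
    obtain rfl := hD.eq_of_notMem_oppositeCone hS hA hvA hv ho hC hC' hwC hjC' hout hjout
    exact .inr ⟨preconnected_induce_of_mem_piecesAfterRemoval hC, j, hjC', ht⟩

theorem DiagramTables.IsFPVD.searchInvariant_univ (hD : D.IsFPVD S) (hS : InGeneralPosition S)
    (hd : d.IsLowerBound S) (v : Fin D.numVertices) : SearchInvariant D S Set.univ d := by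
  obtain ⟨j, hj, -⟩ := hD.exists_reachable_terminal hS v
  refine ⟨hd, .inr ⟨?_, j, trivial, hj⟩⟩
  exact (hD.preconnected_graph hS).map (SimpleGraph.induceUnivIso D.graph).symm.toHom
    (SimpleGraph.induceUnivIso D.graph).symm.surjective

end Search

namespace RealRAM

/-! ### Programs without loops -/

/-- The operation writes to the real register `r`. -/
def Op.writesReal (r : ℕ) : Op → Bool
  | rconst s _ | rcopy s _ | radd s _ _ | rsub s _ _ | rmul s _ _ | rdiv s _ _ | rload s _ _ =>
    s == r
  | _ => false

/-- The operation writes to the index register `r`. -/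
def Op.writesNat (r : ℕ) : Op → Bool
  | nconst s _ | ncopy s _ | nadd s _ _ | nsub s _ _ | nload s _ _ => s == r
  | _ => false

/-- The operation writes to an array. -/
def Op.writesArray : Op → Bool
  | nstore _ _ _ | rstore _ _ _ => true
  | _ => false

namespace Program

/-- Some operation in the program satisfies `f`. -/
def any (f : Op → Bool) : Program → Bool
  | skip => false
  | op o => f o
  | seq P Q | ite _ P Q => P.any f || Q.any f
  | loop _ P => P.any f

/-- The program contains no loop. -/
def loopFree : Program → Bool
  | skip | op _ => true
  | seq P Q | ite _ P Q => P.loopFree && Q.loopFree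
  | loop _ _ => false

/-- The number of operations and tests in a program. -/
def size : Program → ℕ
  | skip => 0
  | op _ => 1
  | seq P Q => P.size + Q.size
  | ite _ P Q => P.size + Q.size + 1
  | loop _ P => P.size + 1

open Classical in
/-- The final state of a program without loops; a loop is treated like `skip`. -/
noncomputable def run : Program → State → State
  | skip, σ => σ
  | op o, σ => o.apply σ
  | seq P Q, σ => Q.run (P.run σ)
  | ite b P Q, σ => if b.Holds σ then P.run σ else Q.run σ
  | loop _ _, σ => σ

instance : Coe Op Program := ⟨op⟩

/-- The programs in a list are executed one after the other. -/
def block : List Program → Program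
  | [] => skip
  | P :: l => seq P (block l)

variable {b : Test} {P Q : Program} {σ : State}

theorem run_ite_pos (h : b.Holds σ) : (ite b P Q).run σ = P.run σ :=
  if_pos h

theorem run_ite_neg (h : ¬b.Holds σ) : (ite b P Q).run σ = Q.run σ :=
  if_neg h

theorem exec_run (hP : P.loopFree = true) (σ : State) : ∃ t ≤ P.size, Exec P σ (P.run σ) t := by
  induction P generalizing σ with
  | skip => exact ⟨0, le_rfl, .skip σ⟩
  | op o => exact ⟨1, le_rfl, .op o σ⟩
  | seq P Q ihP ihQ =>
    rw [loopFree, Bool.and_eq_true] at hP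
    obtain ⟨s, hs, hPs⟩ := ihP hP.1 σ
    obtain ⟨t, ht, hQt⟩ := ihQ hP.2 (P.run σ)
    exact ⟨s + t, add_le_add hs ht, .seq hPs hQt⟩
  | ite b P Q ihP ihQ =>
    rw [loopFree, Bool.and_eq_true] at hP
    by_cases hb : b.Holds σ
    · obtain ⟨s, hs, hPs⟩ := ihP hP.1 σ
      rw [run_ite_pos hb]
      exact ⟨s + 1, by rw [size]; omega, .ite_true hb hPs⟩
    · obtain ⟨s, hs, hQs⟩ := ihQ hP.2 σ
      rw [run_ite_neg hb]
      exact ⟨s + 1, by rw [size]; omega, .ite_false hb hQs⟩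
  | loop b P => cases hP

theorem run_preserves {α : Type*} (g : State → α) {f : Op → Bool}
    (hf : ∀ o σ, f o = false → g (o.apply σ) = g σ) (hP : P.any f = false) (σ : State) :
    g (P.run σ) = g σ := by
  induction P generalizing σ with
  | skip | loop => rfl
  | op o => exact hf o σ hP
  | seq P Q ihP ihQ =>
    rw [any, Bool.or_eq_false_iff] at hP
    exact (ihQ hP.2 _).trans (ihP hP.1 σ)
  | ite b P Q ihP ihQ =>
    rw [any, Bool.or_eq_false_iff] at hP
    by_cases hb : b.Holds σ
    · rw [run_ite_pos hb, ihP hP.1]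
    · rw [run_ite_neg hb, ihQ hP.2]

theorem run_real {r : ℕ} (hP : P.any (Op.writesReal r) = false) (σ : State) :
    (P.run σ).real r = σ.real r := by
  refine run_preserves (fun σ => σ.real r) (fun o σ ho => ?_) hP σ
  cases o <;> simp only [Op.writesReal, Op.apply, beq_eq_false_iff_ne] at ho ⊢ <;>
    exact Function.update_of_ne ho.symm _ _

theorem run_nat {r : ℕ} (hP : P.any (Op.writesNat r) = false) (σ : State) :
    (P.run σ).nat r = σ.nat r := by
  refine run_preserves (fun σ => σ.nat r) (fun o σ ho => ?_) hP σ
  cases o <;> simp only [Op.writesNat, Op.apply, beq_eq_false_iff_ne] at ho ⊢ <;>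
    exact Function.update_of_ne ho.symm _ _

theorem run_natArr (hP : P.any Op.writesArray = false) (σ : State) :
    (P.run σ).natArr = σ.natArr := by
  refine run_preserves State.natArr (fun o σ ho => ?_) hP σ
  cases o <;> first | rfl | cases ho

theorem run_realArr (hP : P.any Op.writesArray = false) (σ : State) :
    (P.run σ).realArr = σ.realArr := by
  refine run_preserves State.realArr (fun o σ ho => ?_) hP σ
  cases o <;> first | rfl | cases ho

end Program

end RealRAM

namespace RealRAM

/-! ### The search program -/

open Program Op Test

/-- Subroutine: the inner product of the vectors from the point in the real registers `o`, `o + 1`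
to the points in `p`, `p + 1` and `q`, `q + 1`. -/
def computeInner (r o p q : ℕ) : Program := block
  [rsub 21 p o, rsub 22 q o, rmul 21 21 22,
    rsub 22 (p + 1) (o + 1), rsub 23 (q + 1) (o + 1), rmul 22 22 23, radd r 21 22]

/-- Subroutine: the cross product of the vectors from the point in the real registers `o`, `o + 1`
to the points in `p`, `p + 1` and `q`, `q + 1`. -/
def computeCross (r o p q : ℕ) : Program := block
  [rsub 21 p o, rsub 22 (q + 1) (o + 1), rmul 21 21 22,
    rsub 22 (p + 1) (o + 1), rsub 23 q o, rmul 22 22 23, rsub r 21 22]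

/-- The number in index register `3` points to a vertex. -/
def loadVertex : Program := block [nsub 6 3 5, rload 6 2 6, rload 7 3 6, nconst 8 0]

/-- Three sites of the vertex, in the given order, go to the real registers `8`–`13`. -/
def loadSites (i j k : Fin 3) : Program := block
  [nload 7 i 6, rload 8 0 7, rload 9 1 7, nload 7 j 6, rload 10 0 7, rload 11 1 7,
    nload 7 k 6, rload 12 0 7, rload 13 1 7]

/-- The midpoint of the first two sites becomes the centre of the candidate. -/
def midpointCandidate : Program := block
  [rconst 21 2, radd 3 8 10, rdiv 3 3 21, radd 4 9 11, rdiv 4 4 21]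

/-- The vertex becomes the centre of the candidate. -/
def vertexCandidate : Program := block [rcopy 3 6, rcopy 4 7]

/-- The index register `9` points to the child that is loaded. -/
def loadChild : Program := block [nsub 10 9 5, rload 15 2 10, rload 16 3 10]

/-- The products of cross products whose signs tell whether the child is in the cone opposite to the
first two sites; the real register `17` contains the cross product of these sites. -/
def coneProducts : Program := block
  [computeCross 18 6 15 10, rmul 18 17 18, computeCross 19 6 8 15, rmul 19 17 19]

/-- The child becomes the next vertex if it is outside of the cone. -/
def selectChild : Program :=
  ite (realLt 20 18) (ncopy 8 9) (ite (realLt 20 19) (ncopy 8 9) skip)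

/-- Child number `k` becomes the next vertex if it exists and is outside of the cone. -/
def testChild (k : Fin 3) : Program := block
  [nload 9 (3 + k) 6, ite (natEq 9 4) skip (block [loadChild, coneProducts, selectChild])]

/-- The visit of a vertex where the first two sites form the longest side of an obtuse triangle. -/
def obtuseVertex : Program := block
  [midpointCandidate, computeCross 17 6 8 10, testChild 0, testChild 1, testChild 2]

/-- Run `obtuseVertex` if the angle at site number `k` is obtuse, and `P` otherwise. -/
def trySites (i j k : Fin 3) (P : Program) : Program := block
  [loadSites i j k, computeInner 14 12 8 10, ite (realLt 14 20) obtuseVertex P]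

/-- The centre of the candidate and the pointer to the next vertex. -/
def visitVertex : Program := block
  [loadVertex, trySites 0 1 2 (trySites 1 2 0 (trySites 2 0 1 vertexCandidate))]

/-- Both kinds of candidates pass through the first site. -/
def candidateRadius : Program := computeInner 5 8 3 3

/-- The candidate becomes the best disk. -/
def setBest : Program := block [rcopy 0 3, rcopy 1 4, rcopy 2 5]

/-- One round of the search. -/
def searchBody : Program := block
  [visitVertex, candidateRadius, ite (realLt 2 5) setBest skip, ncopy 3 8]

/-- The sites of some edge, or one site twice if there is no edge. -/
def chooseSites : Program := block
  [nconst 6 0, nconst 7 0, ite (natLt 6 2) (block [nload 7 10 6, nload 6 9 6]) skip]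

/-- The sites with the indices in the index registers `6` and `7` go to the real registers
`8`–`11`. -/
def loadFirst : Program := block [rload 8 0 6, rload 9 1 6, rload 10 0 7, rload 11 1 7]

/-- The first best disk. -/
def firstBound : Program := block
  [chooseSites, loadFirst, midpointCandidate, candidateRadius, setBest,
    nconst 4 0, nconst 5 1, rconst 20 0]

/-- The search for the smallest enclosing disk in a centroid decomposition. The real registers
`0`–`2` contain the best disk, `3`–`5` the candidate, `6`–`7` the vertex, `8`–`13` its sites and
`20` the constant `0`. The index registers `3` and `8` contain the pointers to the vertex and to the
next one, `4` and `5` the constants `0` and `1`, `6` the index of the vertex. -/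
def diskSearch : Program := seq firstBound (loop (natLt 4 3) searchBody)

/-! ### Subroutines -/

/-- The real registers `r`, `r + 1` contain the coordinates of `x`. -/
structure HoldsPoint (σ : State) (r : ℕ) (x : Plane) : Prop where
  fst : σ.real r = x 0
  snd : σ.real (r + 1) = x 1

/-- The real registers `r`, `r + 1` contain the centre and `r + 2` the squared radius of `d`. -/
structure HoldsDisk (σ : State) (r : ℕ) (d : Disk Plane) : Prop where
  center : HoldsPoint σ r d.center
  sqRadius : σ.real (r + 2) = d.sqRadius

variable {σ : State} {P : Program} {r o p q : ℕ} {x y z : Plane} {d d' : Disk Plane}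

theorem HoldsPoint.run (h : HoldsPoint σ r x) (hr : P.any (writesReal r) = false)
    (hr' : P.any (writesReal (r + 1)) = false) : HoldsPoint (P.run σ) r x :=
  ⟨(run_real hr σ).trans h.fst, (run_real hr' σ).trans h.snd⟩

theorem HoldsDisk.run (h : HoldsDisk σ r d) (hr : P.any (writesReal r) = false)
    (hr' : P.any (writesReal (r + 1)) = false) (hr'' : P.any (writesReal (r + 2)) = false) :
    HoldsDisk (P.run σ) r d :=
  ⟨h.center.run hr hr', (run_real hr'' σ).trans h.sqRadius⟩

theorem run_computeInner (ho : HoldsPoint σ o z) (hp : HoldsPoint σ p x) (hq : HoldsPoint σ q y)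
    (h : o < 20 ∧ p < 20 ∧ q < 20) :
    ((computeInner r o p q).run σ).real r = ⟪x - z, y - z⟫ := by
  simp (disch := omega) only [computeInner, block, Program.run, Op.apply, Function.update_self,
    Function.update_of_ne, ho.fst, ho.snd, hp.fst, hp.snd, hq.fst, hq.snd, inner_plane_eq,
    PiLp.sub_apply]

theorem run_computeCross (ho : HoldsPoint σ o z) (hp : HoldsPoint σ p x) (hq : HoldsPoint σ q y)
    (h : o < 20 ∧ p < 20 ∧ q < 20) :
    ((computeCross r o p q).run σ).real r = cross (x - z) (y - z) := by
  simp (disch := omega) only [computeCross, block, Program.run, Op.apply, Function.update_self,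
    Function.update_of_ne, ho.fst, ho.snd, hp.fst, hp.snd, hq.fst, hq.snd, cross,
    PiLp.sub_apply]

theorem holdsPoint_run_midpointCandidate (hp : HoldsPoint σ 8 x) (hq : HoldsPoint σ 10 y) :
    HoldsPoint (midpointCandidate.run σ) 3 (midpoint ℝ x y) := by
  have hcoord (k : Fin 2) : midpoint ℝ x y k = (x k + y k) / ((2 : ℤ) : ℝ) := by
    rw [midpoint_eq_smul_add, PiLp.smul_apply, PiLp.add_apply, smul_eq_mul, invOf_eq_inv,
      inv_mul_eq_div, Int.cast_ofNat]
  refine ⟨?_, ?_⟩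
  · rw [hcoord, ← hp.fst, ← hq.fst]
    rfl
  · rw [hcoord, ← hp.snd, ← hq.snd]
    rfl

theorem holdsDisk_run_candidateRadius (hc : HoldsPoint σ 3 x) (hp : HoldsPoint σ 8 y) :
    HoldsDisk (candidateRadius.run σ) 3 (Disk.through x y) := by
  refine ⟨hc.run rfl rfl, (run_computeInner hp hc hc (by decide)).trans ?_⟩
  rw [real_inner_self_eq_norm_sq, ← dist_eq_norm]
  rfl

theorem holdsDisk_run_setBest (hd : HoldsDisk σ 3 d) : HoldsDisk (setBest.run σ) 0 d :=
  ⟨⟨hd.center.fst, hd.center.snd⟩, hd.sqRadius⟩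

theorem holdsDisk_run_ite_setBest (hd : HoldsDisk σ 0 d) (hd' : HoldsDisk σ 3 d') :
    HoldsDisk ((ite (realLt 2 5) setBest skip).run σ) 0 (d.larger d') := by
  have hlt : (realLt 2 5).Holds σ ↔ d.sqRadius < d'.sqRadius := by
    rw [← hd.sqRadius, ← hd'.sqRadius]
    rfl
  rw [Disk.larger]
  split_ifs with h
  · rw [run_ite_pos (hlt.2 h)]
    exact holdsDisk_run_setBest hd'
  · rwa [run_ite_neg (hlt.not.2 h)]

end RealRAM

namespace RealRAM

open Program Op Test

/-! ### The visit of a vertex -/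

/-- The part of the input that the search uses, and its constants. -/
structure SearchMemory (σ : State) (D : DiagramTables)
    (child : Fin D.numVertices → Fin 3 → Option (Fin D.numVertices)) : Prop where
  site : ∀ (i : Fin D.numSites) (k : Fin 2), σ.realArr k i = D.site i k
  vertex : ∀ (j : Fin D.numVertices) (k : Fin 2), σ.realArr (2 + k) j = D.vertex j k
  vertexSite : ∀ (j : Fin D.numVertices) (k : Fin 3), σ.natArr k j = D.vertexSite j k
  child : ∀ (j : Fin D.numVertices) (k : Fin 3), σ.natArr (3 + k) j = encodePointer (child j k)
  zero : σ.nat 4 = 0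
  one : σ.nat 5 = 1
  realZero : σ.real 20 = 0

/-- The vertex `v` is being visited. -/
structure AtVertex (σ : State) (D : DiagramTables)
    (child : Fin D.numVertices → Fin 3 → Option (Fin D.numVertices)) (v : Fin D.numVertices) :
    Prop where
  memory : SearchMemory σ D child
  index : σ.nat 6 = v
  point : HoldsPoint σ 6 (D.vertex v)

/-- The vertex `v` is being visited, and the cone opposite to `p` and `q` has been set up. -/
structure AtCone (σ : State) (D : DiagramTables)
    (child : Fin D.numVertices → Fin 3 → Option (Fin D.numVertices)) (v : Fin D.numVertices)
    (p q : Plane) : Prop extends AtVertex σ D child v where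
  left : HoldsPoint σ 8 p
  right : HoldsPoint σ 10 q
  crossSites : σ.real 17 = cross (p - D.vertex v) (q - D.vertex v)

/-- A visit of the vertex `v` has been completed, except for the radius of the candidate. -/
def Visited (σ : State) (D : DiagramTables) (S : Finset Plane)
    (child : Fin D.numVertices → Fin 3 → Option (Fin D.numVertices)) (v : Fin D.numVertices) :
    Prop :=
  ∃ (c p : Plane) (next : Option (Fin D.numVertices)), HoldsPoint σ 3 c ∧ HoldsPoint σ 8 p ∧
    σ.nat 8 = encodePointer next ∧ Visit D S child v (Disk.through c p) next

variable {D : DiagramTables} {child : Fin D.numVertices → Fin 3 → Option (Fin D.numVertices)}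
  {v w : Fin D.numVertices} {S : Finset Plane} {σ : State} {P : Program} {p q r : Plane}

theorem encodePointer_eq_zero {m : ℕ} {j : Option (Fin m)} : encodePointer j = 0 ↔ j = none := by
  cases j <;> simp [encodePointer]

theorem SearchMemory.run (hσ : SearchMemory σ D child) (ha : P.any writesArray = false)
    (h₄ : P.any (writesNat 4) = false) (h₅ : P.any (writesNat 5) = false)
    (h₂₀ : P.any (writesReal 20) = false) : SearchMemory (P.run σ) D child where
  site := run_realArr ha σ ▸ hσ.site
  vertex := run_realArr ha σ ▸ hσ.vertex
  vertexSite := run_natArr ha σ ▸ hσ.vertexSite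
  child := run_natArr ha σ ▸ hσ.child
  zero := (run_nat h₄ σ).trans hσ.zero
  one := (run_nat h₅ σ).trans hσ.one
  realZero := (run_real h₂₀ σ).trans hσ.realZero

theorem SearchMemory.run_loadVertex (hσ : SearchMemory σ D child)
    (hv : σ.nat 3 = v + 1) : AtVertex (loadVertex.run σ) D child v := by
  have hindex : σ.nat 3 - σ.nat 5 = v := by rw [hv, hσ.one, Nat.add_sub_cancel]
  refine ⟨hσ.run rfl rfl rfl rfl, hindex, ?_, ?_⟩
  · rw [← hσ.vertex v 0, ← hindex]
    rfl
  · rw [← hσ.vertex v 1, ← hindex]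
    rfl

theorem AtVertex.holdsPoint_run_loadSites (hσ : AtVertex σ D child v) (i j k : Fin 3) :
    HoldsPoint ((loadSites i j k).run σ) 8 (D.site (D.vertexSite v i)) ∧
      HoldsPoint ((loadSites i j k).run σ) 10 (D.site (D.vertexSite v j)) ∧
        HoldsPoint ((loadSites i j k).run σ) 12 (D.site (D.vertexSite v k)) := by
  have hsite (l : Fin 3) (m : Fin 2) :
      D.site (D.vertexSite v l) m = σ.realArr m (σ.natArr l (σ.nat 6)) := by
    rw [hσ.index, hσ.memory.vertexSite, hσ.memory.site]
  exact ⟨⟨(hsite i 0).symm, (hsite i 1).symm⟩, ⟨(hsite j 0).symm, (hsite j 1).symm⟩,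
    (hsite k 0).symm, (hsite k 1).symm⟩

theorem AtCone.run_testChild (hσ : AtCone σ D child v p q) (k : Fin 3) :
    AtCone ((testChild k).run σ) D child v p q where
  memory := hσ.memory.run rfl rfl rfl rfl
  index := (run_nat rfl σ).trans hσ.index
  point := hσ.point.run rfl rfl
  left := hσ.left.run rfl rfl
  right := hσ.right.run rfl rfl
  crossSites := (run_real rfl σ).trans hσ.crossSites

theorem AtCone.run_loadChild (hσ : AtCone σ D child v p q) (hw : σ.nat 9 = w + 1) :
    AtCone (loadChild.run σ) D child v p q ∧ HoldsPoint (loadChild.run σ) 15 (D.vertex w) := by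
  have hindex : σ.nat 9 - σ.nat 5 = w := by rw [hw, hσ.memory.one, Nat.add_sub_cancel]
  refine ⟨⟨⟨hσ.memory.run rfl rfl rfl rfl, (run_nat rfl σ).trans hσ.index, hσ.point.run rfl rfl⟩,
    hσ.left.run rfl rfl, hσ.right.run rfl rfl, (run_real rfl σ).trans hσ.crossSites⟩, ?_, ?_⟩
  · rw [← hσ.memory.vertex w 0, ← hindex]
    rfl
  · rw [← hσ.memory.vertex w 1, ← hindex]
    rfl

theorem AtCone.run_coneProducts (hσ : AtCone σ D child v p q) {x : Plane}
    (hx : HoldsPoint σ 15 x) :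
    (coneProducts.run σ).real 18 =
        cross (p - D.vertex v) (q - D.vertex v) * cross (x - D.vertex v) (q - D.vertex v) ∧
      (coneProducts.run σ).real 19 =
        cross (p - D.vertex v) (q - D.vertex v) * cross (p - D.vertex v) (x - D.vertex v) := by
  constructor
  · rw [← hσ.crossSites, ← run_computeCross (r := 18) hσ.point hx hσ.right (by decide)]
    rfl
  · let τ := (block [computeCross 18 6 15 10, rmul 18 17 18]).run σ
    have hv : HoldsPoint τ 6 (D.vertex v) := hσ.point.run rfl rfl
    have hp : HoldsPoint τ 8 p := hσ.left.run rfl rfl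
    have hx : HoldsPoint τ 15 x := hx.run rfl rfl
    rw [← hσ.crossSites, ← run_computeCross (r := 19) hv hp hx (by decide)]
    rfl

theorem nat_run_selectChild (σ : State) : (selectChild.run σ).nat 8 =
    if σ.real 20 < σ.real 18 ∨ σ.real 20 < σ.real 19 then σ.nat 9 else σ.nat 8 := by
  by_cases hleft : σ.real 20 < σ.real 18 <;> by_cases hright : σ.real 20 < σ.real 19 <;>
    simp [selectChild, Program.run, Test.Holds, Op.apply, hleft, hright]

theorem AtCone.nat_run_testLoadedChild (hσ : AtCone σ D child v p q)
    (hcross : cross (p - D.vertex v) (q - D.vertex v) ≠ 0) (hw : σ.nat 9 = w + 1) :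
    D.vertex w ∉ oppositeCone (D.vertex v) p q ∧
        ((block [loadChild, coneProducts, selectChild]).run σ).nat 8 = w + 1 ∨
      D.vertex w ∈ oppositeCone (D.vertex v) p q ∧
        ((block [loadChild, coneProducts, selectChild]).run σ).nat 8 = σ.nat 8 := by
  let τ := (block [loadChild, coneProducts]).run σ
  obtain ⟨hcone, hpoint⟩ := hσ.run_loadChild hw
  obtain ⟨h₁₈, h₁₉⟩ := hcone.run_coneProducts hpoint
  have h₂₀ : τ.real 20 = 0 := (run_real rfl σ).trans hσ.memory.realZero
  have hmem : D.vertex w ∉ oppositeCone (D.vertex v) p q ↔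
      τ.real 20 < τ.real 18 ∨ τ.real 20 < τ.real 19 := by
    rw [mem_oppositeCone_iff hcross, ← h₁₈, ← h₁₉, not_and_or, not_le, not_le, h₂₀]
    rfl
  have hselect : ((block [loadChild, coneProducts, selectChild]).run σ).nat 8 =
      if τ.real 20 < τ.real 18 ∨ τ.real 20 < τ.real 19 then (w : ℕ) + 1 else σ.nat 8 := by
    rw [← hw]
    exact nat_run_selectChild τ
  by_cases hout : D.vertex w ∉ oppositeCone (D.vertex v) p q
  · exact .inl ⟨hout, hselect.trans (if_pos (hmem.1 hout))⟩
  · exact .inr ⟨not_not.1 hout, hselect.trans (if_neg (hmem.not.1 hout))⟩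

theorem AtCone.nat_run_testChild (hσ : AtCone σ D child v p q)
    (hcross : cross (p - D.vertex v) (q - D.vertex v) ≠ 0) (k : Fin 3) :
    (∃ w, child v k = some w ∧ D.vertex w ∉ oppositeCone (D.vertex v) p q ∧
        ((testChild k).run σ).nat 8 = w + 1) ∨
      (∀ w, child v k = some w → D.vertex w ∈ oppositeCone (D.vertex v) p q) ∧
        ((testChild k).run σ).nat 8 = σ.nat 8 := by
  let τ := (op (nload 9 (3 + k) 6)).run σ
  have hτ : AtCone τ D child v p q :=
    ⟨⟨hσ.memory.run rfl rfl rfl rfl, hσ.index, hσ.point.run rfl rfl⟩, hσ.left.run rfl rfl,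
      hσ.right.run rfl rfl, hσ.crossSites⟩
  have hpointer : τ.nat 9 = encodePointer (child v k) := by
    rw [← hσ.memory.child v k, ← hσ.index]
    rfl
  have hnull : (natEq 9 4).Holds τ ↔ child v k = none := by
    rw [← encodePointer_eq_zero, ← hpointer, ← hτ.memory.zero]
    rfl
  cases hchild : child v k with
  | none =>
    have hrun : (testChild k).run σ = τ := run_ite_pos (P := skip) (hnull.2 hchild)
    exact .inr ⟨nofun, by rw [hrun]; rfl⟩
  | some w =>
    have hrun : (testChild k).run σ = (block [loadChild, coneProducts, selectChild]).run τ :=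
      run_ite_neg (P := skip) fun h => by rw [hnull, hchild] at h; cases h
    rw [hchild] at hpointer
    rw [hrun]
    rcases hτ.nat_run_testLoadedChild hcross hpointer with h | ⟨hin, hnat⟩
    · exact .inl ⟨w, rfl, h⟩
    · exact .inr ⟨fun _ h => Option.some.inj h ▸ hin, hnat⟩

theorem AtCone.nat_run_testChildren (hσ : AtCone σ D child v p q)
    (hcross : cross (p - D.vertex v) (q - D.vertex v) ≠ 0) :
    (∃ i w, child v i = some w ∧ D.vertex w ∉ oppositeCone (D.vertex v) p q ∧
        ((block [testChild 0, testChild 1, testChild 2]).run σ).nat 8 = w + 1) ∨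
      (∀ i w, child v i = some w → D.vertex w ∈ oppositeCone (D.vertex v) p q) ∧
        ((block [testChild 0, testChild 1, testChild 2]).run σ).nat 8 = σ.nat 8 := by
  have hσ₁ := hσ.run_testChild 0
  have hσ₂ := hσ₁.run_testChild 1
  rcases hσ₂.nat_run_testChild hcross 2 with ⟨w, hw⟩ | ⟨hin₂, h₂⟩
  · exact .inl ⟨2, w, hw⟩
  rcases hσ₁.nat_run_testChild hcross 1 with ⟨w, hw, hout, h₁⟩ | ⟨hin₁, h₁⟩
  · exact .inl ⟨1, w, hw, hout, h₂.trans h₁⟩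
  rcases hσ.nat_run_testChild hcross 0 with ⟨w, hw, hout, h₀⟩ | ⟨hin₀, h₀⟩
  · exact .inl ⟨0, w, hw, hout, (h₂.trans h₁).trans h₀⟩
  · exact .inr ⟨Fin.forall_fin_succ.2 ⟨hin₀, Fin.forall_fin_two.2 ⟨hin₁, hin₂⟩⟩,
      (h₂.trans h₁).trans h₀⟩

theorem AtVertex.visited_run_obtuseVertex (hσ : AtVertex σ D child v) (h₈ : σ.nat 8 = 0)
    (hp : HoldsPoint σ 8 p) (hq : HoldsPoint σ 10 q) (hv : DefinesVertex S p q r (D.vertex v))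
    (ho : Obtuse p q r) : Visited (obtuseVertex.run σ) D S child v := by
  let τ := (block [midpointCandidate, computeCross 17 6 8 10]).run σ
  have hcross : cross (p - D.vertex v) (q - D.vertex v) ≠ 0 :=
    ho.cross_ne_zero hv.dist_eq.1 hv.dist_eq.2
  have hτ : AtCone τ D child v p q :=
    ⟨⟨hσ.memory.run rfl rfl rfl rfl, (run_nat rfl σ).trans hσ.index, hσ.point.run rfl rfl⟩,
      hp.run rfl rfl, hq.run rfl rfl,
      run_computeCross (hσ.point.run rfl rfl) (hp.run rfl rfl) (hq.run rfl rfl) (by decide)⟩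
  have hmidpoint : HoldsPoint (obtuseVertex.run σ) 3 (midpoint ℝ p q) :=
    (holdsPoint_run_midpointCandidate hp hq).run
      (P := block [computeCross 17 6 8 10, testChild 0, testChild 1, testChild 2]) rfl rfl
  have hpoint : HoldsPoint (obtuseVertex.run σ) 8 p := hp.run rfl rfl
  rcases hτ.nat_run_testChildren hcross with ⟨i, w, hw, hout, hnext⟩ | ⟨hin, hnext⟩
  · exact ⟨_, p, some w, hmidpoint, hpoint, hnext, .descend hv ho hw hout⟩
  · exact ⟨_, p, none, hmidpoint, hpoint, hnext.trans h₈, .stuck hv ho hin⟩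

theorem AtVertex.visited_run_trySites (hσ : AtVertex σ D child v) (h₈ : σ.nat 8 = 0) {i j k : Fin 3}
    (hv : DefinesVertex S (D.site (D.vertexSite v i)) (D.site (D.vertexSite v j))
      (D.site (D.vertexSite v k)) (D.vertex v))
    (hP : ∀ τ, AtVertex τ D child v → τ.nat 8 = 0 →
      HoldsPoint τ 8 (D.site (D.vertexSite v i)) → ¬Obtuse (D.site (D.vertexSite v i))
        (D.site (D.vertexSite v j)) (D.site (D.vertexSite v k)) → Visited (P.run τ) D S child v) :
    Visited ((trySites i j k P).run σ) D S child v := by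
  let τ := (block [loadSites i j k, computeInner 14 12 8 10]).run σ
  obtain ⟨hp, hq, hr⟩ := hσ.holdsPoint_run_loadSites i j k
  have hτ : AtVertex τ D child v :=
    ⟨hσ.memory.run rfl rfl rfl rfl, (run_nat rfl σ).trans hσ.index, hσ.point.run rfl rfl⟩
  have hp' : HoldsPoint τ 8 (D.site (D.vertexSite v i)) := hp.run rfl rfl
  have hobtuse : (realLt 14 20).Holds τ ↔ Obtuse (D.site (D.vertexSite v i))
      (D.site (D.vertexSite v j)) (D.site (D.vertexSite v k)) := by
    rw [Obtuse, ← run_computeInner (r := 14) hr hp hq (by decide), ← hτ.memory.realZero]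
    rfl
  have h₈' : τ.nat 8 = 0 := (run_nat rfl σ).trans h₈
  change Visited ((ite (realLt 14 20) obtuseVertex P).run τ) D S child v
  by_cases ho : (realLt 14 20).Holds τ
  · rw [run_ite_pos ho]
    exact hτ.visited_run_obtuseVertex h₈' hp' (hq.run rfl rfl) hv (hobtuse.1 ho)
  · rw [run_ite_neg ho]
    exact hP τ hτ h₈' hp' (hobtuse.not.1 ho)

theorem SearchMemory.visited_run_visitVertex (hσ : SearchMemory σ D child)
    (h₃ : σ.nat 3 = v + 1) (hD : D.IsFPVD S) : Visited (visitVertex.run σ) D S child v := by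
  have hv := hD.vertexSite_spec v
  refine (hσ.run_loadVertex h₃).visited_run_trySites rfl hv fun τ hτ h₈ _ h => ?_
  refine hτ.visited_run_trySites h₈ hv.rotate fun τ hτ h₈ _ h' => ?_
  refine hτ.visited_run_trySites h₈ hv.rotate.rotate fun τ hτ h₈ hp h'' => ?_
  exact ⟨D.vertex v, _, none, ⟨hτ.point.fst, hτ.point.snd⟩, hp.run rfl rfl, h₈,
    .optimal (hv.rotate.rotate.isOptimal_through h'' h h')⟩

end RealRAM

/-! ### The first disk -/

namespace DiagramTables.IsFPVD

variable {D : DiagramTables} {S : Finset Plane}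

theorem site_mem (hD : D.IsFPVD S) (i : Fin D.numSites) : D.site i ∈ S := by
  rw [← Finset.mem_coe, ← hD.site_range]
  exact Set.mem_range_self i

theorem isOptimal_diametral_edgeSite (hD : D.IsFPVD S) (hV : IsEmpty (Fin D.numVertices))
    (e : Fin D.numEdges) :
    (Disk.diametral (D.site (D.edgeSite e 0)) (D.site (D.edgeSite e 1))).IsOptimal S := by
  obtain ⟨ha, hb, hab, x, hx, -⟩ := hD.edgeSite_spec e
  refine (isOptimal_diametral_iff ha hb).2 (hD.mem_fpvdEdge_of_isEmpty hV ha hb hab hx ?_).1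
  rw [dist_midpoint_left, dist_midpoint_right]

theorem isOptimal_diametral_self (hD : D.IsFPVD S) (hV : IsEmpty (Fin D.numVertices))
    (hE : D.numEdges = 0) {p : Plane} (hp : p ∈ S) : (Disk.diametral p p).IsOptimal S := by
  refine (isOptimal_diametral_iff hp hp).2 fun q hq => ?_
  by_cases hqp : q = p
  · rw [hqp]
  · exact absurd hE (hD.numEdges_pos_of_isEmpty hV hq hp hqp).ne'

theorem numVertices_le (hD : D.IsFPVD S) : D.numVertices ≤ S.card ^ 3 := by
  have hsites : D.numSites = S.card := by
    rw [← Set.ncard_coe_finset, ← hD.site_range, Set.ncard_range_of_injective hD.site_injective,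
      Nat.card_fin]
  have hinj : Function.Injective D.vertexSite := by
    intro i j hij
    obtain ⟨-, -, -, -, -, -, hi⟩ := hD.vertexSite_spec i
    obtain ⟨-, -, -, -, -, -, hj⟩ := hD.vertexSite_spec j
    rw [hij] at hi
    exact hD.vertex_injective (Set.singleton_injective (hi.symm.trans hj))
  have hcard := Fintype.card_le_of_injective _ hinj
  rwa [Fintype.card_fun, Fintype.card_fin, Fintype.card_fin, Fintype.card_fin, hsites] at hcard

end DiagramTables.IsFPVD

namespace RealRAM

open Program Op Test

/-! ### The search -/

variable {D : DiagramTables} {child : Fin D.numVertices → Fin 3 → Option (Fin D.numVertices)}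
  {root : Option (Fin D.numVertices)} {v : Fin D.numVertices} {S : Finset Plane} {σ : State}
  {d : Disk Plane}

theorem HoldsInput.exists_nat_run_chooseSites (hσ : HoldsInput σ D root child) (hD : D.IsFPVD S)
    (hS : S.Nonempty) : ∃ i j : Fin D.numSites, (chooseSites.run σ).nat 6 = i ∧
      (chooseSites.run σ).nat 7 = j ∧
      ((∃ e, i = D.edgeSite e 0 ∧ j = D.edgeSite e 1) ∨ D.numEdges = 0 ∧ i = j) := by
  let τ := (block [nconst 6 0, nconst 7 0]).run σ
  have htest : (natLt 6 2).Holds τ ↔ 0 < D.numEdges := by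
    rw [← hσ.numEdges]
    rfl
  change ∃ i j : Fin D.numSites,
    ((ite (natLt 6 2) (block [nload 7 10 6, nload 6 9 6]) skip).run τ).nat 6 = i ∧
      ((ite (natLt 6 2) (block [nload 7 10 6, nload 6 9 6]) skip).run τ).nat 7 = j ∧ _
  by_cases hE : 0 < D.numEdges
  · rw [run_ite_pos (htest.2 hE)]
    exact ⟨_, _, hσ.edgeSite ⟨0, hE⟩ 0, hσ.edgeSite ⟨0, hE⟩ 1, .inl ⟨_, rfl, rfl⟩⟩
  · rw [run_ite_neg (htest.not.2 hE)]
    obtain ⟨p, hp⟩ := hS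
    obtain ⟨i, -⟩ : p ∈ Set.range D.site := hD.site_range ▸ hp
    exact ⟨⟨0, i.pos⟩, ⟨0, i.pos⟩, rfl, rfl, .inr ⟨Nat.eq_zero_of_not_pos hE, rfl⟩⟩

theorem HoldsInput.exists_holdsDisk_run_firstBound (hσ : HoldsInput σ D root child)
    (hD : D.IsFPVD S) (hS : S.Nonempty) : ∃ d, HoldsDisk (firstBound.run σ) 0 d ∧
      d.IsLowerBound S ∧ (IsEmpty (Fin D.numVertices) → d.IsOptimal S) := by
  obtain ⟨i, j, hi, hj, hij⟩ := hσ.exists_nat_run_chooseSites hD hS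
  have hsite (l : Fin D.numSites) (k : Fin 2) :
      (chooseSites.run σ).realArr k l = D.site l k := by
    rw [run_realArr rfl, hσ.site]
  have hp : HoldsPoint ((block [chooseSites, loadFirst]).run σ) 8 (D.site i) := by
    constructor <;> rw [← hsite, ← hi] <;> rfl
  have hq : HoldsPoint ((block [chooseSites, loadFirst]).run σ) 10 (D.site j) := by
    constructor <;> rw [← hsite, ← hj] <;> rfl
  have hdisk := holdsDisk_run_setBest
    (holdsDisk_run_candidateRadius (holdsPoint_run_midpointCandidate hp hq) (hp.run rfl rfl))
  refine ⟨_, hdisk.run (P := block [nconst 4 0, nconst 5 1, rconst 20 0]) rfl rfl rfl,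
    Disk.isLowerBound_diametral (hD.site_mem i) (hD.site_mem j), fun hV => ?_⟩
  rcases hij with ⟨e, rfl, rfl⟩ | ⟨hE, rfl⟩
  · exact hD.isOptimal_diametral_edgeSite hV e
  · exact hD.isOptimal_diametral_self hV hE (hD.site_mem i)

theorem HoldsInput.searchMemory_run_firstBound (hσ : HoldsInput σ D root child) :
    SearchMemory (firstBound.run σ) D child where
  site := run_realArr (P := firstBound) rfl σ ▸ hσ.site
  vertex := run_realArr (P := firstBound) rfl σ ▸ hσ.vertex
  vertexSite := run_natArr (P := firstBound) rfl σ ▸ hσ.vertexSite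
  child := run_natArr (P := firstBound) rfl σ ▸ hσ.child
  zero := rfl
  one := rfl
  realZero := Int.cast_zero

theorem SearchMemory.exists_visit_run_searchBody (hσ : SearchMemory σ D child)
    (h₃ : σ.nat 3 = v + 1) (hd : HoldsDisk σ 0 d) (hD : D.IsFPVD S) :
    ∃ d' next, Visit D S child v d' next ∧ (searchBody.run σ).nat 3 = encodePointer next ∧
      HoldsDisk (searchBody.run σ) 0 (d.larger d') := by
  obtain ⟨c, p, next, hc, hp, hnext, hvisit⟩ := hσ.visited_run_visitVertex h₃ hD
  let τ := (block [visitVertex, candidateRadius]).run σ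
  have hdisk := holdsDisk_run_ite_setBest (σ := τ) (hd.run rfl rfl rfl)
    (holdsDisk_run_candidateRadius hc hp)
  refine ⟨_, next, hvisit, ?_, hdisk.run (P := ncopy 3 8) rfl rfl rfl⟩
  rw [← hnext]
  exact run_nat (r := 8) (P := block [candidateRadius, ite (realLt 2 5) setBest skip]) rfl _

theorem SearchMemory.holds_natLt_iff (hσ : SearchMemory σ D child) :
    (natLt 4 3).Holds σ ↔ 0 < σ.nat 3 := by
  rw [← hσ.zero]
  rfl

theorem SearchMemory.exists_exec_search {A : Set (Fin D.numVertices)}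
    (hσ : SearchMemory σ D child) (hD : D.IsFPVD S) (hS : InGeneralPosition S)
    (hA : IsCentroidTree D.graph child A v) (hinv : SearchInvariant D S A d)
    (h₃ : σ.nat 3 = v + 1) (hd : HoldsDisk σ 0 d) :
    ∃ τ t k d', Exec (loop (natLt 4 3) searchBody) σ τ t ∧ t ≤ (searchBody.size + 1) * k + 1 ∧
      2 ^ k ≤ 2 * A.ncard ∧ d'.IsOptimal S ∧ HoldsDisk τ 0 d' := by
  induction hn : A.ncard using Nat.strong_induction_on generalizing σ A v d with
  | h n ih =>
  subst hn
  have hpos : 0 < A.ncard := (Set.ncard_pos).2 ⟨v, by cases hA; assumption⟩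
  have hstart : (natLt 4 3).Holds σ := hσ.holds_natLt_iff.2 (h₃ ▸ Nat.succ_pos _)
  obtain ⟨s, hs, hbody⟩ := exec_run (P := searchBody) rfl σ
  have hσ' : SearchMemory (searchBody.run σ) D child := hσ.run rfl rfl rfl rfl
  obtain ⟨d', next, hvisit, hnext, hd'⟩ := hσ.exists_visit_run_searchBody h₃ hd hD
  cases next with
  | none =>
    have hend : ¬(natLt 4 3).Holds (searchBody.run σ) := by
      rw [hσ'.holds_natLt_iff, hnext]
      exact lt_irrefl 0
    exact ⟨_, _, 1, _, .loop_true hstart hbody (.loop_false hend), by omega, by omega,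
      hinv.isOptimal_larger hD hS hA hvisit, hd'⟩
  | some w =>
    obtain ⟨C, hcard, hC, hinv'⟩ := hinv.exists_piece hD hS hA hvisit
    obtain ⟨τ, t, k, e, hrest, ht, hk, he, hτ⟩ :=
      ih C.ncard (by omega) hσ' hC hinv' hnext hd' rfl
    exact ⟨τ, _, k + 1, e, .loop_true hstart hbody hrest, by rw [mul_add]; omega,
      by rw [pow_succ]; omega, he, hτ⟩

theorem holdsSmallestEnclosingDisk_of_isOptimal (hd : HoldsDisk σ 0 d) (h : d.IsOptimal S) :
    HoldsSmallestEnclosingDisk σ S :=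
  ⟨d.center, √d.sqRadius, h.isSmallestEnclosingDisk, hd.center.fst, hd.center.snd,
    hd.sqRadius.trans (Real.sq_sqrt h.sqRadius_nonneg).symm⟩

theorem exists_exec_diskSearch (hσ : HoldsInput σ D root child) (hD : D.IsFPVD S)
    (hne : S.Nonempty) (hS : InGeneralPosition S)
    (hroot : IsCentroidDecomposition D.graph root child) :
    ∃ τ t k, Exec diskSearch σ τ t ∧ t ≤ firstBound.size + (searchBody.size + 1) * k + 1 ∧
      2 ^ k ≤ 2 * S.card ^ 3 ∧ HoldsSmallestEnclosingDisk τ S := by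
  obtain ⟨s, hs, hfirst⟩ := exec_run (P := firstBound) rfl σ
  have hmemory := hσ.searchMemory_run_firstBound
  have hpointer : (firstBound.run σ).nat 3 = encodePointer root := (run_nat rfl σ).trans hσ.root
  obtain ⟨d, hd, hlower, hopt⟩ := hσ.exists_holdsDisk_run_firstBound hD hne
  cases root with
  | none =>
    have hend : ¬(natLt 4 3).Holds (firstBound.run σ) := by
      rw [hmemory.holds_natLt_iff, hpointer]
      exact lt_irrefl 0
    exact ⟨_, _, 0, .seq hfirst (.loop_false hend), by omega,
      by have := Nat.pow_pos (n := 3) hne.card_pos; omega,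
      holdsSmallestEnclosingDisk_of_isOptimal hd (hopt (hroot.1 rfl))⟩
  | some v =>
    obtain ⟨τ, t, k, d', hsearch, ht, hk, hd', hτ⟩ := hmemory.exists_exec_search hD hS
      (hroot.2 v rfl) (hD.searchInvariant_univ hS hlower v) hpointer hd
    rw [Set.ncard_univ, Nat.card_fin] at hk
    exact ⟨τ, _, k, .seq hfirst hsearch, by omega, hk.trans (by gcongr; exact hD.numVertices_le),
      holdsSmallestEnclosingDisk_of_isOptimal hτ hd'⟩

end RealRAM

theorem natCast_le_of_two_pow_le {n k : ℕ} (h : 2 ^ k ≤ 2 * n ^ 3) :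
    (k : ℝ) ≤ 1 + 6 * Real.log n := by
  have hn : 0 < n := by
    by_contra! hn
    simp [Nat.le_zero.1 hn] at h
  have hpow : (2 : ℝ) ^ k ≤ 2 * (n : ℝ) ^ 3 := by exact_mod_cast h
  have hlog := Real.log_le_log (by positivity) hpow
  rw [Real.log_pow, Real.log_mul (by norm_num) (by positivity), Real.log_pow] at hlog
  push_cast at hlog
  have hlog_two := Real.log_two_gt_d9
  have hlog_nonneg := Real.log_natCast_nonneg n
  by_contra! hk
  nlinarith

theorem mainTheorem5 :
    ∃ (P : RealRAM.Program) (K : ℝ),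
      ∀ S : Finset Plane, S.Nonempty → InGeneralPosition S →
      ∀ D : DiagramTables, D.IsFPVD S →
      ∀ (root : Option (Fin D.numVertices))
        (child : Fin D.numVertices → Fin 3 → Option (Fin D.numVertices)),
        IsCentroidDecomposition D.graph root child →
      ∀ σ : RealRAM.State, RealRAM.HoldsInput σ D root child →
      ∃ (τ : RealRAM.State) (t : ℕ), RealRAM.Exec P σ τ t ∧
        (t : ℝ) ≤ K * (1 + Real.log (S.card : ℝ)) ∧
        RealRAM.HoldsSmallestEnclosingDisk τ S := by
  refine ⟨RealRAM.diskSearch,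
    RealRAM.firstBound.size + 1 + 6 * (RealRAM.searchBody.size + 1), ?_⟩
  intro S hne hS D hD root child hroot σ hσ
  obtain ⟨τ, t, k, hexec, ht, hk, hτ⟩ := RealRAM.exists_exec_diskSearch hσ hD hne hS hroot
  refine ⟨τ, t, hexec, ?_, hτ⟩
  have hlog : 0 ≤ Real.log S.card := Real.log_natCast_nonneg _
  calc (t : ℝ)
      ≤ RealRAM.firstBound.size + (RealRAM.searchBody.size + 1) * k + 1 := by exact_mod_cast ht
    _ ≤ RealRAM.firstBound.size + (RealRAM.searchBody.size + 1) * (1 + 6 * Real.log S.card) + 1 :=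
        by gcongr; exact natCast_le_of_two_pow_le hk
    _ ≤ _ := by
        nlinarith [mul_nonneg RealRAM.firstBound.size.cast_nonneg hlog]
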